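/- All groups are countable and discrete, $\mathbb T$ is the circle group, and $L(G)$ is the group von Neumann algebra of $G$ on $\ell^2(G)$. **Definitions.** Let $\Omega\in H^2(G,C)$ and $\Omega'\in H^2(G,D)$, where $C,D$ are countable abelian groups with trivial $G$-action, and let $\widehat C=\operatorname{Hom}(C,\mathbb T)$. Write $\Theta(\Omega):\widehat C\to H^2(G,\mathbb T)$, $\mu\mapsto\mu\circ\Omega$. For an isomorphism $\zeta:C_0\to D_0$ between subgroups $C_0<C$, $D_0<D$, say that $\Omega,\Omega'$ match along $\zeta$ if $\mu\circ\Omega=\omega\circ\Omega'$ in $H^2(G,\mathbb T)$ whenever $\mu\in\widehat C$, $\omega\in\widehat D$ satisfy $\omega\circ\zeta=\mu|_{C_0}$. Write - $\Omega\approx\Omega'$ if $C=D$ and $\Theta(\Omega)=\Theta(\Omega')$; - $\Omega\sim^t\Omega'$ (for $t>0$) if they match along some $\zeta$ with $[C:C_0]\,t=[D:D_0]$ (indices in $\mathbb N\cup\{\infty\}$), and $\Omega\sim\Omega'$ if $\Omega\sim^t\Omega'$ for some $t>0$; - $\Omega\approx_{v}\Omega'$ if they match along some $\zeta$ with $[C:C_0]<\infty$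 and $[D:D_0]<\infty$. For fixed $\Omega\in H^2(G,C)$, let $\mathcal H_{\sim^t}$ (resp. $\mathcal H_\approx$) be the class of countable groups isomorphic to a central extension of $G$ by a countable abelian group $D$ with associated $\Omega'\in H^2(G,D)$ satisfying $\Omega\sim^t\Omega'$ (resp. $\Omega\approx\Omega'$). Let $\mathcal F_\sim$ (resp. $\mathcal F_{\approx_v}$) be the class of countable groups isomorphic to a central extension of a finite index subgroup $G_0<G$ by a countable abelian group $D$ with associated $\Omega'\in H^2(G_0,D)$ satisfying $\Omega'\sim\Omega|_{G_0}$ (resp. $\Omega'\approx_v\Omega|_{G_0}$). Two groups $G,\Lambda$ are virtually isomorphic if $G_1/N\cong\Lambda_1/\Sigma$ for some finite index subgroups $G_1<G$, $\Lambda_1<\Lambda$ and finite normal subgroups $N\lhd G_1$, $\Sigma\lhd\Lambda_1$. A Hilbert bimodule over two finite von Neumann algebras is bifinite if it is of finite type both as a left and as a right Hilbert module, i.e. on each side isomorphic to a closed submodule of a finite direct sum of copies of the standard $L^2$-space; it is faithful if both actions are faithful. A group is icc if every nontrivial conjugacy class is infinite. **Proposition.** Let $G$ be a countable icc group, $C$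 a countable torsion free abelian group and $0\to C\to\widetilde G\to G\to e$ a central extension with associated $2$-cocycle $\Omega\in H^2(G,C)$. (a) If $\Theta(\Omega)$ is not faithful, there is a countable group $\widetilde\Lambda\in\mathcal H_{\sim^1}\setminus\mathcal H_\approx$ such that $L(\widetilde\Lambda)\cong L(\widetilde G)$ but $\widetilde\Lambda\not\cong\widetilde G$. (b) If $\Theta(\Omega|_{G_0}):\widehat C\to H^2(G_0,\mathbb T)$ has infinite kernel for some finite index subgroup $G_0<G$, there is a countable group $\widetilde\Lambda\in\mathcal F_\sim$ such that there exists a faithful bifinite $L(\widetilde\Lambda)$-$L(\widetilde G)$-bimodule, but $\widetilde\Lambda$ is not virtually isomorphic to $\widetilde G$, nor to any group in $\mathcal F_{\approx_v}$. -/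

import Mathlib

open scoped ENNReal ComplexConjugate InnerProductSpace

universe u

/-! All abelian groups are written multiplicatively. -/

section Groups

/-- A group is icc if every nontrivial conjugacy class is infinite. -/
def IsICC (G : Type*) [Group G] : Prop :=
  ∀ g : G, g ≠ 1 → (conjugatesOf g).Infinite

/-- Virtual isomorphism of groups: `G₁ ⧸ N ≃* Λ₁ ⧸ S` for some finite index subgroups `G₁`, `Λ₁`
and finite normal subgroups `N` of `G₁` and `S` of `Λ₁`. -/
def VirtuallyIsomorphic (G Λ : Type*) [Group G] [Group Λ] : Prop :=
  ∃ (G₁ : Subgroup G) (Λ₁ : Subgroup Λ) (N : Subgroup G₁) (S : Subgroup Λ₁)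
    (_ : N.Normal) (_ : S.Normal),
    G₁.FiniteIndex ∧ Λ₁.FiniteIndex ∧ Finite N ∧ Finite S ∧ Nonempty (G₁ ⧸ N ≃* Λ₁ ⧸ S)

end Groups

section Cohomology

/-- The group `Z²(G, A)` of normalized `2`-cocycles, for the trivial action of `G` on `A`. -/
def Z2 (G A : Type*) [Group G] [CommGroup A] : Subgroup (G → G → A) where
  carrier := {f | (∀ g h k, f g h * f (g * h) k = f g (h * k) * f h k) ∧
    (∀ g, f g 1 = 1) ∧ ∀ g, f 1 g = 1}
  one_mem' := by simp
  mul_mem' := by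
    rintro a b ⟨ha, ha1, ha2⟩ ⟨hb, hb1, hb2⟩
    refine ⟨fun g h k => ?_, fun g => ?_, fun g => ?_⟩
    · simp only [Pi.mul_apply]
      rw [mul_mul_mul_comm, ha, hb, mul_mul_mul_comm]
    · simp [ha1, hb1]
    · simp [ha2, hb2]
  inv_mem' := by
    rintro a ⟨ha, ha1, ha2⟩
    refine ⟨fun g h k => ?_, fun g => ?_, fun g => ?_⟩
    · simp only [Pi.inv_apply]
      rw [← mul_inv, ha, mul_inv]
    · simp [ha1]
    · simp [ha2]

/-- The subgroup `B²(G, A)` of coboundaries `(g, h) ↦ F g * F h * (F (g * h))⁻¹` with `F 1 = 1`. -/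
def B2 (G A : Type*) [Group G] [CommGroup A] : Subgroup (Z2 G A) where
  carrier := {f | ∃ F : G → A, F 1 = 1 ∧ ∀ g h, f.1 g h = F g * F h * (F (g * h))⁻¹}
  one_mem' := ⟨1, by simp, by simp⟩
  mul_mem' := by
    rintro a b ⟨F, hF1, hF⟩ ⟨F', hF1', hF'⟩
    refine ⟨F * F', by simp [hF1, hF1'], fun g h => ?_⟩
    simp only [Subgroup.coe_mul, Pi.mul_apply, hF, hF', mul_inv]
    rw [mul_mul_mul_comm, mul_mul_mul_comm (F g)]
  inv_mem' := by
    rintro a ⟨F, hF1, hF⟩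
    refine ⟨F⁻¹, by simp [hF1], fun g h => ?_⟩
    simp only [Subgroup.coe_inv, Pi.inv_apply, hF, mul_inv]

/-- The second cohomology group `H²(G, A)` with trivial action. -/
abbrev H2 (G A : Type*) [Group G] [CommGroup A] : Type _ := Z2 G A ⧸ B2 G A

/-- A homomorphism `f : G' → G` and a homomorphism `φ : A → B` of coefficients
induce `Z²(G, A) → Z²(G', B)`, `ω ↦ φ ∘ ω ∘ (f × f)`. -/
def Z2.map {G G' A B : Type*} [Group G] [Group G'] [CommGroup A] [CommGroup B]
    (f : G' →* G) (φ : A →* B) : Z2 G A →* Z2 G' B where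
  toFun ω := ⟨fun g h => φ (ω.1 (f g) (f h)),
    fun g h k => by simp only [map_mul f, ← map_mul φ, ω.2.1],
    fun g => by simp [ω.2.2.1], fun g => by simp [ω.2.2.2]⟩
  map_one' := by
    apply Subtype.ext
    funext g h
    simp
  map_mul' a b := by
    apply Subtype.ext
    funext g h
    simp

/-- The map `H²(G, A) → H²(G', B)` induced by `f : G' → G` and `φ : A → B`. -/
def H2.map {G G' A B : Type*} [Group G] [Group G'] [CommGroup A] [CommGroup B]
    (f : G' →* G) (φ : A →* B) : H2 G A →* H2 G' B :=
  QuotientGroup.map _ _ (Z2.map f φ) (by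
    rintro a ⟨F, hF1, hF⟩
    refine ⟨fun g => φ (F (f g)), by simp [hF1], fun g h => ?_⟩
    change φ (a.1 (f g) (f h)) = _
    simp [hF])

/-- `μ ∘ Ω` for `Ω ∈ H²(G, C)` and a homomorphism `μ : C → A`. -/
abbrev H2.push {G C A : Type*} [Group G] [CommGroup C] [CommGroup A]
    (μ : C →* A) (Ω : H2 G C) : H2 G A :=
  H2.map (MonoidHom.id G) μ Ω

/-- The restriction of `Ω ∈ H²(G, C)` to a subgroup. -/
abbrev H2.restrict {G C : Type*} [Group G] [CommGroup C] (G₀ : Subgroup G) (Ω : H2 G C) :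
    H2 G₀ C :=
  H2.map G₀.subtype (MonoidHom.id C) Ω

/-- `Θ(Ω) : Ĉ → H²(G, 𝕋)`, `μ ↦ μ ∘ Ω`. As `C` is discrete, the group underlying its Pontryagin
dual `Ĉ` consists of all homomorphisms from `C` to the circle. -/
noncomputable def Theta {G C : Type*} [Group G] [CommGroup C] (Ω : H2 G C) : (C →* Circle) →* H2 G Circle where
  toFun μ := H2.push μ Ω
  map_one' := by
    induction Ω using QuotientGroup.induction_on with
    | H ω => rfl
  map_mul' μ ν := by
    induction Ω using QuotientGroup.induction_on with
    | H ω => rfl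

/-- A group extension `1 → C → E → G → 1` is central. -/
def GroupExtension.IsCentral {C E G : Type*} [CommGroup C] [Group E] [Group G]
    (S : GroupExtension C E G) : Prop :=
  S.inl.range ≤ Subgroup.center E

/-- `Ω ∈ H²(G, C)` is the class associated with the extension `1 → C → E → G → 1`: it is represented
by the cocycle `ω` with `σ g * σ h = ω(g, h) * σ (g * h)` for a lift `σ : G → E`. -/
def GroupExtension.HasClass {C E G : Type*} [CommGroup C] [Group E] [Group G]
    (S : GroupExtension C E G) (Ω : H2 G C) : Prop :=
  ∃ (σ : G → E) (ω : Z2 G C), σ 1 = 1 ∧ (∀ g, S.rightHom (σ g) = g) ∧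
    (∀ g h, σ g * σ h = S.inl (ω.1 g h) * σ (g * h)) ∧ (QuotientGroup.mk ω : H2 G C) = Ω

/-- `μ ∘ Ω = ω ∘ Ω'` in `H²(G, 𝕋)` for all characters `μ` of `C` and `ω` of `D`
with `ω ∘ ζ = μ|_{C₀}`. -/
def MatchesAlong {G C D : Type*} [Group G] [CommGroup C] [CommGroup D]
    (Ω : H2 G C) (Ω' : H2 G D) {C₀ : Subgroup C} {D₀ : Subgroup D} (ζ : C₀ ≃* D₀) : Prop :=
  ∀ (μ : C →* Circle) (ω : D →* Circle), (∀ c : C₀, ω (ζ c) = μ c) →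
    H2.push μ Ω = H2.push ω Ω'

/-- The index of a subgroup, as an element of `[0, ∞]`. -/
noncomputable def eIndex {C : Type*} [Group C] (C₀ : Subgroup C) : ℝ≥0∞ :=
  (ENat.card (C ⧸ C₀) : ℝ≥0∞)

/-- The relation `Ω ≈ Ω'`. -/
def CocycleApprox {G C : Type*} [Group G] [CommGroup C] (Ω Ω' : H2 G C) : Prop :=
  ∀ μ : C →* Circle, H2.push μ Ω = H2.push μ Ω'

/-- The relation `Ω ∼ᵗ Ω'`, meant for `t > 0`: there is an isomorphism `ζ : C₀ → D₀` between
subgroups with `[C : C₀] t = [D : D₀]` along which `Ω` and `Ω'` match. -/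
def CocycleSimT {G C D : Type*} [Group G] [CommGroup C] [CommGroup D]
    (t : ℝ) (Ω : H2 G C) (Ω' : H2 G D) : Prop :=
  ∃ (C₀ : Subgroup C) (D₀ : Subgroup D) (ζ : C₀ ≃* D₀),
    eIndex C₀ * ENNReal.ofReal t = eIndex D₀ ∧ MatchesAlong Ω Ω' ζ

/-- The relation `Ω ∼ Ω'`: `Ω ∼ᵗ Ω'` for some `t > 0`. -/
def CocycleSim {G C D : Type*} [Group G] [CommGroup C] [CommGroup D]
    (Ω : H2 G C) (Ω' : H2 G D) : Prop :=
  ∃ t : ℝ, 0 < t ∧ CocycleSimT t Ω Ω'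

/-- The relation `Ω ≈ᵥ Ω'`: as `∼`, with both subgroups of finite index. -/
def CocycleApproxVirtual {G C D : Type*} [Group G] [CommGroup C] [CommGroup D]
    (Ω : H2 G C) (Ω' : H2 G D) : Prop :=
  ∃ (C₀ : Subgroup C) (D₀ : Subgroup D) (ζ : C₀ ≃* D₀),
    C₀.FiniteIndex ∧ D₀.FiniteIndex ∧ MatchesAlong Ω Ω' ζ

/-- The class `ℋ_{∼ᵗ}` of `Ω`: countable groups that are central extensions of `G` by a countable
abelian group `D` whose class `Ω'` satisfies `Ω ∼ᵗ Ω'`. -/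
def ClassHSim {G C : Type u} [Group G] [CommGroup C] (t : ℝ) (Ω : H2 G C)
    (Λ : Type u) [Group Λ] : Prop :=
  Countable Λ ∧ ∃ (D : Type u) (_ : CommGroup D) (_ : Countable D) (S : GroupExtension D Λ G)
    (Ω' : H2 G D), S.IsCentral ∧ S.HasClass Ω' ∧ CocycleSimT t Ω Ω'

/-- The class `ℋ_≈` of `Ω`: countable groups that are central extensions of `G` by `C`
whose class `Ω'` satisfies `Ω ≈ Ω'`. -/
def ClassHApprox {G C : Type u} [Group G] [CommGroup C] (Ω : H2 G C)
    (Λ : Type u) [Group Λ] : Prop :=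
  Countable Λ ∧ ∃ (S : GroupExtension C Λ G) (Ω' : H2 G C),
    S.IsCentral ∧ S.HasClass Ω' ∧ CocycleApprox Ω Ω'

/-- The class `ℱ_∼` of `Ω`: countable groups that are central extensions of a finite index subgroup
`G₀` of `G` by a countable abelian group `D` whose class `Ω'` satisfies `Ω' ∼ Ω|_{G₀}`. -/
def ClassFSim {G C : Type u} [Group G] [CommGroup C] (Ω : H2 G C)
    (Λ : Type u) [Group Λ] : Prop :=
  Countable Λ ∧ ∃ (G₀ : Subgroup G) (D : Type u) (_ : CommGroup D) (_ : Countable D)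
    (S : GroupExtension D Λ G₀) (Ω' : H2 G₀ D), G₀.FiniteIndex ∧ S.IsCentral ∧ S.HasClass Ω' ∧
    CocycleSim Ω' (Ω.restrict G₀)

/-- The class `ℱ_{≈ᵥ}` of `Ω`: as `ℱ_∼`, with `Ω' ≈ᵥ Ω|_{G₀}`. -/
def ClassFApproxVirtual {G C : Type u} [Group G] [CommGroup C] (Ω : H2 G C)
    (Λ : Type u) [Group Λ] : Prop :=
  Countable Λ ∧ ∃ (G₀ : Subgroup G) (D : Type u) (_ : CommGroup D) (_ : Countable D)
    (S : GroupExtension D Λ G₀) (Ω' : H2 G₀ D), G₀.FiniteIndex ∧ S.IsCentral ∧ S.HasClass Ω' ∧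
    CocycleApproxVirtual Ω' (Ω.restrict G₀)

end Cohomology

section VonNeumann

/-- The Hilbert space `ℓ²(X)`. -/
abbrev Ell2 (X : Type*) : Type _ := lp (fun _ : X => ℂ) 2

theorem Ell2.memℓp_comp {X Y : Type*} (e : X ≃ Y) (ξ : Ell2 Y) :
    Memℓp (fun x : X => ξ (e x)) 2 := by
  have h : (0 : ℝ) < (2 : ℝ≥0∞).toReal := by simp
  refine (memℓp_gen_iff h).2 ?_
  exact (e.summable_iff (f := fun y => ‖ξ y‖ ^ (2 : ℝ≥0∞).toReal)).2
    ((memℓp_gen_iff h).1 (lp.memℓp ξ))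

/-- The unitary `ℓ²(Y) → ℓ²(X)`, `ξ ↦ ξ ∘ e`, of a bijection `e : X → Y`. -/
noncomputable def Ell2.comp {X Y : Type*} (e : X ≃ Y) : Ell2 Y ≃ₗᵢ[ℂ] Ell2 X where
  toFun ξ := ⟨fun x => ξ (e x), Ell2.memℓp_comp e ξ⟩
  invFun ξ := ⟨fun y => ξ (e.symm y), Ell2.memℓp_comp e.symm ξ⟩
  map_add' ξ η := by ext; rfl
  map_smul' c ξ := by ext; rfl
  left_inv ξ := by ext y; simp
  right_inv ξ := by ext x; simp
  norm_map' ξ := by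
    have h : (0 : ℝ) < (2 : ℝ≥0∞).toReal := by simp
    rw [lp.norm_eq_tsum_rpow h, lp.norm_eq_tsum_rpow h]
    congr 1
    exact e.tsum_eq (fun y => ‖ξ y‖ ^ (2 : ℝ≥0∞).toReal)

/-- The coordinatewise complex conjugation on `ℓ²(X)`. -/
noncomputable def Ell2.conj (X : Type*) : Ell2 X ≃ₗᵢ⋆[ℂ] Ell2 X where
  toFun ξ := star ξ
  invFun ξ := star ξ
  map_add' ξ η := star_add ξ η
  map_smul' c ξ := by ext; simp
  left_inv ξ := star_star ξ
  right_inv ξ := star_star ξ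
  norm_map' ξ := norm_star ξ

variable (G : Type*) [Group G]

/-- The left regular representation: `(λ_g ξ)(h) = ξ(g⁻¹ h)`. -/
noncomputable def leftRegular (g : G) : Ell2 G →L[ℂ] Ell2 G :=
  (Ell2.comp (Equiv.mulLeft g⁻¹)).toContinuousLinearEquiv.toContinuousLinearMap

/-- The von Neumann algebra generated by a set `s` of bounded operators:
the bicommutant of `s ∪ s*`. -/
noncomputable def generatedVN {H : Type*} [NormedAddCommGroup H] [InnerProductSpace ℂ H]
    [CompleteSpace H] (s : Set (H →L[ℂ] H)) : VonNeumannAlgebra H where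
  toStarSubalgebra :=
    StarSubalgebra.centralizer ℂ (StarSubalgebra.centralizer ℂ s : Set (H →L[ℂ] H))
  centralizer_centralizer' := by
    change Set.centralizer (Set.centralizer (((StarSubalgebra.centralizer ℂ
      (StarSubalgebra.centralizer ℂ s : Set (H →L[ℂ] H)) :
        StarSubalgebra ℂ (H →L[ℂ] H)) : Set (H →L[ℂ] H)))) = ((StarSubalgebra.centralizer ℂ
      (StarSubalgebra.centralizer ℂ s : Set (H →L[ℂ] H)) :
        StarSubalgebra ℂ (H →L[ℂ] H)) : Set (H →L[ℂ] H))
    rw [StarSubalgebra.coe_centralizer_centralizer, Set.centralizer_centralizer_centralizer]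

/-- The group von Neumann algebra `L(G)`, generated by the left regular representation
on `ℓ²(G)`. -/
noncomputable def groupVN : VonNeumannAlgebra (Ell2 G) :=
  generatedVN (Set.range (leftRegular G))

/-- `L(G)` as a `*`-algebra. -/
abbrev LvN : Type _ := (groupVN G).toStarSubalgebra

/-- The modular conjugation `(J ξ)(g) = conj (ξ(g⁻¹))` on `ℓ²(G) = L²(L(G))`. -/
noncomputable def modularConj : Ell2 G ≃ₗᵢ⋆[ℂ] Ell2 G :=
  (Ell2.comp (Equiv.inv G)).trans (Ell2.conj G)

variable {G}

/-- The right action `ξ ↦ ξ · b = J b* J ξ` of `b ∈ L(G)` on `ℓ²(G) = L²(L(G))`. -/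
noncomputable def rightAct (b : LvN G) (ξ : Ell2 G) : Ell2 G :=
  modularConj G ((star b).1 (modularConj G ξ))

variable (Γ Λ : Type*) [Group Γ] [Group Λ]

/-- A bifinite Hilbert `L(Γ)`-`L(Λ)`-bimodule `K`: commuting unital `*`-representations of `L(Γ)`
and of the opposite algebra of `L(Λ)` on `K` such that the left module `K` is isomorphic to a closed
submodule of a finite direct sum of copies of `L²(L(Γ)) = ℓ²(Γ)`, and the right module `K` to a
closed submodule of a finite direct sum of copies of `L²(L(Λ)) = ℓ²(Λ)`. (The last two conditions
imply that both actions are normal. The range of an isometry is automatically closed.) -/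
structure BifiniteBimodule (K : Type*) [NormedAddCommGroup K] [InnerProductSpace ℂ K]
    [CompleteSpace K] where
  left : LvN Γ →⋆ₐ[ℂ] (K →L[ℂ] K)
  right : (LvN Λ)ᵐᵒᵖ →⋆ₐ[ℂ] (K →L[ℂ] K)
  left_right_comm : ∀ a b, Commute (left a) (right b)
  left_finite : ∃ (n : ℕ) (V : K →ₗᵢ[ℂ] PiLp 2 (fun _ : Fin n => Ell2 Γ)),
    ∀ (a : LvN Γ) (ξ : K) (i : Fin n), V (left a ξ) i = a.1 (V ξ i)
  right_finite : ∃ (n : ℕ) (V : K →ₗᵢ[ℂ] PiLp 2 (fun _ : Fin n => Ell2 Λ)),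
    ∀ (b : LvN Λ) (ξ : K) (i : Fin n), V (right (MulOpposite.op b) ξ) i = rightAct b (V ξ i)

/-- Both actions are faithful. -/
def BifiniteBimodule.IsFaithful {Γ Λ K : Type*} [Group Γ] [Group Λ] [NormedAddCommGroup K]
    [InnerProductSpace ℂ K] [CompleteSpace K] (B : BifiniteBimodule Γ Λ K) : Prop :=
  Function.Injective B.left ∧ Function.Injective B.right

/-- There exists a faithful bifinite Hilbert `L(Γ)`-`L(Λ)`-bimodule. -/
def ExistsFaithfulBifiniteBimodule (Γ Λ : Type u) [Group Γ] [Group Λ] : Prop :=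
  ∃ (K : Type u) (_ : NormedAddCommGroup K) (_ : InnerProductSpace ℂ K) (_ : CompleteSpace K)
    (B : BifiniteBimodule Γ Λ K), B.IsFaithful

end VonNeumann

/-! For an abelian group `C` with dual `X`, the evaluations form an orthonormal basis of `L²(X)`,
and `L(C)` becomes `L^∞(X)`. `IsFourierModel` isolates what is needed of such a homomorphism `u`
from `C` to circle-valued functions. The algebra of a central extension of `G` by `C` then sees only
the class of `u ∘ Ω` with values in these functions. If a different group `D` has a model `π` on the
same space and `π ∘ Ω'` is cohomologous to `u ∘ Ω`, the two group von Neumann algebras are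
isomorphic (`exists_intertwinesGroupVN`). A nontrivial kernel of `Θ(Ω)` leaves room to choose a `D`
with torsion.

A character of `C` is in the kernel of `Θ(Ω)` exactly when it extends to the extension `Γ`, so it is
trivial on the kernel `C₀` of the map from `C` to the abelianization of `Γ`. If `Θ(Ω)` has infinite
kernel, `C ⧸ C₀` is infinite. Then `C ⧸ C₀` and `(C ⧸ C₀) × V` both have models on the unit
interval, for every countable abelian `V`. The quotient of the two models on `C ⧸ C₀` takes values
in a divisible group, hence extends to `Γ`; on a section of `Γ → G` this extension is the required
coboundary. So `C` may be replaced by `C × V` (`GroupExtension.exists_cocycle_prod`).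

If instead the kernel contains `μ` of prime order `p`, then `C` may be replaced by `ker μ × C ⧸ ker
μ` (`GroupExtension.exists_cocycle_of_orderOf_prime`). The part of `Ω` outside `ker μ` is an integer
cocycle, which is a coboundary over the reals; real powers of a circle-valued function exist once a
measurable logarithm is chosen.

The groups are told apart by torsion. In a central extension of an icc group every finite conjugacy
class lies in the kernel. For (a), the new group has nontrivial central torsion, which an extension
of `G` by the torsion free `C` cannot have. For (b), `V` is an infinite group of exponent two.
Infinitely many torsion elements with finite conjugacy class then pass to every virtually isomorphic
group, while the original group and the groups in the class of `≈ᵥ` have only finitely many. The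
bimodule is `ℓ²` of the whole extension, restricted on the left to the preimage of `G₀`. -/

open MeasureTheory

/-! ### Extension of homomorphisms into divisible groups -/

/-- Homomorphisms into an abelian group all of whose elements have roots extend from subgroups. -/
theorem MonoidHom.exists_extension_of_rootable {A B D : Type*} [CommGroup A] [CommGroup B]
    [CommGroup D] (hD : ∀ n : ℕ, n ≠ 0 → ∀ d : D, ∃ e : D, e ^ n = d)
    (i : A →* B) (hi : Function.Injective i) (f : A →* D) : ∃ F : B →* D, F.comp i = f := by
  have hD' : ∀ n : ℤ, n ≠ 0 → ∀ d : D, ∃ e : D, e ^ n = d := by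
    intro n hn d
    obtain ⟨e, he⟩ := hD n.natAbs (by simpa using hn) d
    rcases Int.natAbs_eq n with h | h
    · exact ⟨e, by rw [h, zpow_natCast, he]⟩
    · exact ⟨e⁻¹, by rw [h, zpow_neg, inv_zpow, inv_inv, zpow_natCast, he]⟩
  choose! r hr using hD'
  -- Divisible abelian groups are injective by Baer's criterion. The value `0` at `n = 0` is the
  -- convention of `DivisibleBy`.
  let : DivisibleBy (Additive D) ℤ :=
    { div := fun d n => if n = 0 then 0 else Additive.ofMul (r n d.toMul)
      div_zero := fun d => by simp
      div_cancel := fun {n} d hn => by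
        rw [if_neg hn, ← ofMul_zpow, hr n hn]; rfl }
  obtain ⟨h, hh⟩ := (Module.Baer.of_divisible (Additive D)).extension_property_addMonoidHom
    (MonoidHom.toAdditive i) hi (MonoidHom.toAdditive f)
  refine ⟨MonoidHom.toAdditive.symm h, ?_⟩
  ext a
  exact congrArg Additive.toMul (DFunLike.congr_fun hh (Additive.ofMul a))

/-! ### Circle-valued measurable functions -/

/-- The group of measurable maps from `X` to the circle. -/
def CircleMaps (X : Type*) [MeasurableSpace X] : Subgroup (X → Circle) where
  carrier := {f | Measurable fun x => (f x : ℂ)}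
  one_mem' := by simp
  mul_mem' := by
    intro a b ha hb
    simpa [Pi.mul_def] using ha.mul hb
  inv_mem' := by
    intro a ha
    simp only [Set.mem_ofPred_eq, Pi.inv_apply, Circle.coe_inv_eq_conj] at *
    exact (Complex.continuous_conj.measurable).comp ha

namespace CircleMaps

variable {X Y : Type*} [MeasurableSpace X] [MeasurableSpace Y]

theorem measurable_coe (f : CircleMaps X) : Measurable fun x => (f.1 x : ℂ) := f.2

/-- The element of `CircleMaps X` given by a measurable real angle. -/
noncomputable def ofAngle (a : X → ℝ) (ha : Measurable a) : CircleMaps X :=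
  ⟨fun x => Circle.exp (a x), by
    change Measurable fun x => ((Circle.exp (a x) : Circle) : ℂ)
    simp only [Circle.coe_exp]
    fun_prop⟩

theorem exists_ofAngle (f : CircleMaps X) :
    ∃ (a : X → ℝ) (ha : Measurable a), f = ofAngle a ha := by
  refine ⟨fun x => Complex.arg (f.1 x), Complex.measurable_arg.comp f.2, ?_⟩
  apply Subtype.ext
  funext x
  exact (Circle.exp_arg (f.1 x)).symm

/-- The principal argument is measurable and can be divided by `n`. Thus `CircleMaps X` is
divisible, and homomorphisms into it extend from subgroups. -/
theorem exists_pow_eq (n : ℕ) (hn : n ≠ 0) (f : CircleMaps X) : ∃ g : CircleMaps X, g ^ n = f := by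
  obtain ⟨a, ha, rfl⟩ := exists_ofAngle f
  refine ⟨ofAngle (fun x => a x / n) (ha.div_const _), ?_⟩
  apply Subtype.ext
  funext x
  change Circle.exp (a x / n) ^ n = Circle.exp (a x)
  rw [← Circle.exp_natCast_mul]
  congr 1
  field_simp

/-- Precomposition with a measurable map. -/
def comp (g : Y → X) (hg : Measurable g) : CircleMaps X →* CircleMaps Y where
  toFun f := ⟨fun y => f.1 (g y), f.2.comp hg⟩
  map_one' := rfl
  map_mul' _ _ := rfl

end CircleMaps

/-! ### Characters and Fourier models -/

theorem Circle.exists_pow_eq (n : ℕ) (hn : n ≠ 0) (z : Circle) : ∃ w : Circle, w ^ n = z := by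
  refine ⟨Circle.exp (Complex.arg z / n), ?_⟩
  rw [← Circle.exp_natCast_mul]
  convert Circle.exp_arg z using 2
  field_simp

/-- Characters of an abelian group separate its points. -/
theorem exists_character_ne_one {C : Type*} [CommGroup C] {c : C} (hc : c ≠ 1) :
    ∃ χ : C →* Circle, χ c ≠ 1 := by
  -- Any such `z` is an admissible nontrivial image of `c`. If `c` has infinite order, `orderOf c =
  -- 0`, the first equation is void and `-1` serves.
  obtain ⟨z, hz, hz1⟩ : ∃ z : Circle, z ^ orderOf c = 1 ∧ z ≠ 1 := by
    rcases Nat.eq_zero_or_pos (orderOf c) with h | h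
    · refine ⟨Circle.exp Real.pi, by simp [h], fun h1 => ?_⟩
      have := congrArg (fun z : Circle => (z : ℂ)) h1
      norm_num [Circle.coe_exp] at this
    · have hne : orderOf c ≠ 0 := h.ne'
      have hp := Complex.isPrimitiveRoot_exp (orderOf c) hne
      refine ⟨Circle.exp (2 * Real.pi / orderOf c), ?_, fun h1 => ?_⟩
      · rw [← Circle.exp_natCast_mul, mul_div_cancel₀ _ (by exact_mod_cast hne)]
        simp
      · have h2 : Complex.exp (2 * Real.pi * Complex.I / orderOf c) = 1 := by
          have := congrArg (fun z : Circle => (z : ℂ)) h1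
          simp only [Circle.coe_exp, Circle.coe_one] at this
          rw [← this]
          push_cast
          ring_nf
        rw [h2] at hp
        exact hc (orderOf_eq_one_iff.1 (hp.unique IsPrimitiveRoot.one))
  let φ : Multiplicative ℤ →* C := zpowersHom C c
  have hker : ∀ k ∈ φ.ker, zpowersHom Circle z k = 1 := by
    intro k hk
    have h1 : c ^ k.toAdd = 1 := hk
    rw [zpowersHom_apply]
    obtain ⟨m, hm⟩ := orderOf_dvd_iff_zpow_eq_one.2 h1
    rw [hm, zpow_mul, zpow_natCast, hz, one_zpow]
  obtain ⟨F, hF⟩ := MonoidHom.exists_extension_of_rootable Circle.exists_pow_eq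
    (QuotientGroup.kerLift φ) (QuotientGroup.kerLift_injective φ)
    (QuotientGroup.lift φ.ker (zpowersHom Circle z) hker)
  refine ⟨F, fun h => hz1 ?_⟩
  have := DFunLike.congr_fun hF (QuotientGroup.mk (Multiplicative.ofAdd (1 : ℤ)))
  change F (φ (Multiplicative.ofAdd 1)) = zpowersHom Circle z (Multiplicative.ofAdd 1) at this
  simpa [φ, h, eq_comm] using this

/-- A homomorphism `u` from an abelian group to the circle-valued measurable functions of a measure
space is a Fourier model if its nontrivial values have integral zero and its values separate
integrable functions. -/
structure IsFourierModel {C X : Type*} [CommGroup C] [MeasurableSpace X] (μ : Measure X)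
    (u : C →* CircleMaps X) : Prop where
  integral_eq_zero : ∀ c, c ≠ 1 → ∫ x, ((u c).1 x : ℂ) ∂μ = 0
  ae_eq_zero : ∀ f : X → ℂ, Integrable f μ → (∀ c, ∫ x, ((u c).1 x : ℂ) * f x ∂μ = 0) →
    f =ᵐ[μ] 0

namespace CircleMaps

variable {X Y : Type*} [MeasurableSpace X] [MeasurableSpace Y] {μ : Measure X}

@[simp] theorem coe_mul_apply (f g : CircleMaps X) (x : X) :
    (((f * g : CircleMaps X).1 x : Circle) : ℂ) = (f.1 x : ℂ) * (g.1 x : ℂ) := rfl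

@[simp] theorem coe_inv_apply (f : CircleMaps X) (x : X) :
    (((f⁻¹ : CircleMaps X).1 x : Circle) : ℂ) = conj (f.1 x : ℂ) := Circle.coe_inv_eq_conj _

@[simp] theorem coe_one_apply (x : X) : (((1 : CircleMaps X).1 x : Circle) : ℂ) = 1 := rfl

theorem norm_apply (f : CircleMaps X) (x : X) : ‖(f.1 x : ℂ)‖ = 1 := Circle.norm_coe _

theorem integrable_mul (f : CircleMaps X) {g : X → ℂ} (hg : Integrable g μ) :
    Integrable (fun x => (f.1 x : ℂ) * g x) μ :=
  hg.bdd_mul f.2.aestronglyMeasurable (c := 1) (ae_of_all _ fun x => (norm_apply f x).le)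

end CircleMaps

/-! ### Fourier models of group extensions -/

section Product

variable {D Q X Y : Type*} [CommGroup D] [CommGroup Q] [MeasurableSpace X] [MeasurableSpace Y]
  {μ : Measure X} {ν : Measure Y} [IsProbabilityMeasure μ] [IsProbabilityMeasure ν]

/-- The homomorphism `d ↦ ((x, y) ↦ s d x * v (q d) y)`. -/
noncomputable def productModel (s : D →* CircleMaps X) (v : Q →* CircleMaps Y) (q : D →* Q) :
    D →* CircleMaps (X × Y) :=
  (CircleMaps.comp Prod.fst measurable_fst).comp s *
    ((CircleMaps.comp Prod.snd measurable_snd).comp v).comp q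

theorem productModel_apply (s : D →* CircleMaps X) (v : Q →* CircleMaps Y) (q : D →* Q) (d : D)
    (z : X × Y) :
    ((productModel s v q d).1 z : ℂ) = ((s d).1 z.1 : ℂ) * ((v (q d)).1 z.2 : ℂ) := rfl

/-- If `1 → N → D → Q → 1` is exact, `s` restricts to a Fourier model of `N` and `v` is a Fourier
model of `Q`, then their product is a Fourier model of `D`. -/
theorem isFourierModel_productModel {N : Type*} [CommGroup N] [Countable Q] {s : D →* CircleMaps X}
    {v : Q →* CircleMaps Y} {q : D →* Q} (n : N →* D) (hq : Function.Surjective q)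
    (hqn : ∀ m, q (n m) = 1) (hnq : ∀ d, q d = 1 → ∃ m, n m = d) (hv : IsFourierModel ν v)
    (hs : IsFourierModel μ (s.comp n)) :
    IsFourierModel (μ.prod ν) (productModel s v q) := by
  constructor
  · intro d hd
    simp only [productModel_apply]
    rw [integral_prod_mul (fun x => ((s d).1 x : ℂ)) (fun y => ((v (q d)).1 y : ℂ))]
    by_cases h : q d = 1
    · obtain ⟨m, rfl⟩ := hnq d h
      have := hs.integral_eq_zero m fun hm => hd (by rw [hm, map_one])
      simp only [MonoidHom.comp_apply] at this
      rw [this, zero_mul]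
    · rw [hv.integral_eq_zero _ h, mul_zero]
  · intro f hf h
    -- Fix a fibre of `q`. Letting `d` run through it tests the partial integral in `y` against the
    -- model of `N`, shifted by `s d`, so this partial integral vanishes for almost every `x`. As
    -- `Q` is countable, one null set serves all `k`, and then the model of `Q` applies in `y`.
    have key : ∀ k : Q, ∀ᵐ x ∂μ, ∫ y, ((v k).1 y : ℂ) * f (x, y) ∂ν = 0 := by
      intro k
      obtain ⟨d, rfl⟩ := hq k
      have hint : Integrable (fun z : X × Y => ((v (q d)).1 z.2 : ℂ) * f z) (μ.prod ν) :=
        CircleMaps.integrable_mul (CircleMaps.comp Prod.snd measurable_snd (v (q d))) hf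
      have h1 : ∀ d' : D, q d' = q d →
          ∫ x, ((s d').1 x : ℂ) * ∫ y, ((v (q d)).1 y : ℂ) * f (x, y) ∂ν ∂μ = 0 := by
        intro d' hd'
        rw [← h d', integral_prod]
        · refine integral_congr_ae (ae_of_all _ fun x => ?_)
          simp only [productModel_apply, hd', mul_assoc]
          rw [integral_const_mul]
        · exact CircleMaps.integrable_mul _ hf
      have h2 := hs.ae_eq_zero (fun x => ((s d).1 x : ℂ) * ∫ y, ((v (q d)).1 y : ℂ) * f (x, y) ∂ν)
        (CircleMaps.integrable_mul _ hint.integral_prod_left) (fun m => by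
          have := h1 (n m * d) (by rw [map_mul, hqn, one_mul])
          simpa [map_mul, mul_assoc] using this)
      filter_upwards [h2] with x hx
      simpa using hx
    have key' : ∀ᵐ x ∂μ, ∀ᵐ y ∂ν, f (x, y) = 0 := by
      filter_upwards [ae_all_iff.2 key, hf.prod_right_ae] with x hx hx'
      exact hv.ae_eq_zero _ hx' hx
    have h3 : ∫ z, ‖f z‖ ∂(μ.prod ν) = 0 := by
      rw [integral_prod _ hf.norm]
      refine integral_eq_zero_of_ae ?_
      filter_upwards [key'] with x hx
      refine integral_eq_zero_of_ae ?_
      filter_upwards [hx] with y hy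
      simp [hy]
    have h4 := (integral_eq_zero_iff_of_nonneg (fun z => norm_nonneg (f z)) hf.norm).1 h3
    filter_upwards [h4] with z hz
    simpa using hz

end Product

/-! ### The dual group with its Haar measure -/

section Haar

variable (C : Type*) [CommGroup C]

/-- The dual of a discrete abelian group, as a subgroup of the group of all functions from it to
the circle. -/
def dualSubgroup : Subgroup (C → Circle) where
  carrier := {f | ∀ a b, f (a * b) = f a * f b}
  one_mem' := by simp
  mul_mem' := by
    intro f g hf hg a b
    simp only [Pi.mul_apply, hf a b, hg a b]
    exact mul_mul_mul_comm _ _ _ _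
  inv_mem' := by
    intro f hf a b
    simp only [Pi.inv_apply, hf a b, mul_inv]

theorem isClosed_dualSubgroup : IsClosed (dualSubgroup C : Set (C → Circle)) := by
  have : (dualSubgroup C : Set (C → Circle)) = ⋂ a, ⋂ b, {f | f (a * b) = f a * f b} := by
    ext f
    simp [dualSubgroup]
  rw [this]
  refine isClosed_iInter fun a => isClosed_iInter fun b => isClosed_eq ?_ ?_ <;> fun_prop

instance : CompactSpace (dualSubgroup C) :=
  isCompact_iff_compactSpace.1 (isClosed_dualSubgroup C).isCompact

noncomputable instance : MeasurableSpace (dualSubgroup C) := borel _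

instance : BorelSpace (dualSubgroup C) := ⟨rfl⟩

variable {C} in
theorem continuous_dual_apply (c : C) :
    Continuous fun χ : dualSubgroup C => ((χ.1 c : Circle) : ℂ) :=
  (continuous_subtype_val (p := fun z : ℂ => z ∈ Submonoid.unitSphere ℂ)).comp ((continuous_apply c).comp continuous_subtype_val)

variable {C} in
/-- The continuous function on the dual given by evaluation at a point. -/
noncomputable def dualContinuousEval (c : C) : C((dualSubgroup C), ℂ) :=
  ⟨fun χ => ((χ.1 c : Circle) : ℂ), continuous_dual_apply c⟩

instance [Countable C] : PolishSpace (dualSubgroup C) :=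
  haveI : PolishSpace Circle := inferInstance
  (isClosed_dualSubgroup C).polishSpace

/-- The evaluation homomorphism from an abelian group to the functions on its dual. -/
noncomputable def dualEval : C →* CircleMaps (dualSubgroup C) where
  toFun c := ⟨fun χ => χ.1 c, (continuous_dual_apply c).measurable⟩
  map_one' := by
    apply Subtype.ext
    funext χ
    have h : χ.1 (1 * 1) = χ.1 1 * χ.1 1 := χ.2 1 1
    simpa using h
  map_mul' a b := by
    apply Subtype.ext
    funext χ
    exact χ.2 a b

/-- The normalized Haar measure of the dual. -/
noncomputable def dualHaar : Measure (dualSubgroup C) :=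
  Measure.haarMeasure ⊤

instance : IsProbabilityMeasure (dualHaar C) :=
  ⟨by simpa using! Measure.haarMeasure_self (K₀ := (⊤ : TopologicalSpace.PositiveCompacts (dualSubgroup C)))⟩

instance : (dualHaar C).IsMulLeftInvariant := by
  unfold dualHaar; infer_instance

/-- The evaluations span a dense subspace of the continuous functions on the dual. -/
theorem dualEval_span_dense (h : C((dualSubgroup C), ℂ)) :
    h ∈ (Submodule.span ℂ (Set.range (dualContinuousEval (C := C)))).topologicalClosure := by
  set e : C → C((dualSubgroup C), ℂ) := dualContinuousEval
  have he : ∀ a b, e (a * b) = e a * e b := by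
    intro a b; ext χ
    change ((χ.1 (a * b) : Circle) : ℂ) = (χ.1 a : ℂ) * (χ.1 b : ℂ)
    rw [χ.2 a b]; rfl
  have he1 : e 1 = 1 := by
    ext χ
    have := (CircleMaps.coe_one_apply χ)
    rw [← map_one (dualEval C)] at this
    exact this
  have heinv : ∀ a, e a⁻¹ = star (e a) := by
    intro a; ext χ
    have := (CircleMaps.coe_inv_apply (dualEval C a) χ)
    rw [← map_inv] at this
    exact this
  -- The evaluations are closed under products and conjugation, so their span is already a star
  -- subalgebra, and Stone–Weierstrass applies.
  let A : StarSubalgebra ℂ C((dualSubgroup C), ℂ) :=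
    { carrier := Submodule.span ℂ (Set.range e)
      mul_mem' := by
        intro a b ha hb
        have h1 := Submodule.mul_mem_mul ha hb
        rw [Submodule.span_mul_span] at h1
        refine Submodule.span_mono ?_ h1
        rintro _ ⟨_, ⟨x, rfl⟩, _, ⟨y, rfl⟩, rfl⟩
        exact ⟨x * y, he x y⟩
      add_mem' := fun ha hb => Submodule.add_mem _ ha hb
      algebraMap_mem' := fun r => by
        rw [Algebra.algebraMap_eq_smul_one, ← he1]
        exact Submodule.smul_mem _ _ (Submodule.subset_span ⟨1, rfl⟩)
      star_mem' := by
        intro a ha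
        refine Submodule.span_induction ?_ ?_ ?_ ?_ ha
        · rintro _ ⟨c, rfl⟩
          exact Submodule.subset_span ⟨c⁻¹, heinv c⟩
        · simp
        · intro x y _ _ hx hy
          rw [star_add]; exact Submodule.add_mem _ hx hy
        · intro r x _ hx
          rw [star_smul]; exact Submodule.smul_mem _ _ hx }
  have hA : A.SeparatesPoints := by
    intro χ ψ hne
    have : ∃ c, χ.1 c ≠ ψ.1 c := by
      by_contra hcon
      push Not at hcon
      exact hne (Subtype.ext (funext hcon))
    obtain ⟨c, hc⟩ := this
    exact ⟨e c, ⟨e c, Submodule.subset_span ⟨c, rfl⟩, rfl⟩, fun h => hc (Subtype.ext h)⟩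
  have := ContinuousMap.starSubalgebra_topologicalClosure_eq_top_of_separatesPoints A hA
  have h2 : h ∈ A.topologicalClosure := by rw [this]; trivial
  exact h2

/-- Translation by a character that is not `1` at `c` multiplies the integral of the evaluation at
`c` by a number other than `1`, yet preserves it. For completeness, vanishing coefficients give zero
integral against every continuous function by density, then over every closed set by outer
approximation of its indicator. -/
theorem isFourierModel_dualEval [Countable C] : IsFourierModel (dualHaar C) (dualEval C) := by
  constructor
  · intro c hc
    obtain ⟨ψ, hψ⟩ := exists_character_ne_one hc
    let ψ' : dualSubgroup C := ⟨ψ, fun a b => map_mul ψ a b⟩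
    have h := integral_mul_left_eq_self (μ := dualHaar C)
      (fun χ : dualSubgroup C => ((χ.1 c : Circle) : ℂ)) ψ'
    have h2 : ∫ χ : dualSubgroup C, (((ψ' * χ).1 c : Circle) : ℂ) ∂(dualHaar C) =
        (ψ c : ℂ) * ∫ χ : dualSubgroup C, ((χ.1 c : Circle) : ℂ) ∂(dualHaar C) := by
      rw [← integral_const_mul]
      rfl
    rw [h2] at h
    by_contra hne
    refine hψ (Circle.ext (mul_right_cancel₀ hne ?_))
    rw [Circle.coe_one, one_mul]
    exact h
  · intro f hf h
    have hcont : ∀ g : C((dualSubgroup C), ℂ), ∫ χ, g χ * f χ ∂(dualHaar C) = 0 := by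
      have hint : ∀ g : C((dualSubgroup C), ℂ), Integrable (fun χ => g χ * f χ) (dualHaar C) :=
        fun g => hf.bdd_mul g.continuous.aestronglyMeasurable (c := ‖g‖)
          (ae_of_all _ fun x => g.norm_coe_le_norm x)
      let Φ : C((dualSubgroup C), ℂ) →L[ℂ] ℂ := LinearMap.mkContinuous
        { toFun := fun g => ∫ χ, g χ * f χ ∂(dualHaar C)
          map_add' := fun a b => by
            simp only [ContinuousMap.add_apply, add_mul]
            exact integral_add (hint a) (hint b)
          map_smul' := fun r a => by
            simp only [ContinuousMap.smul_apply, smul_eq_mul, mul_assoc, RingHom.id_apply]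
            exact integral_const_mul _ _ } (∫ χ, ‖f χ‖ ∂(dualHaar C)) (fun g => by
          simp only [LinearMap.coe_mk, AddHom.coe_mk]
          rw [← integral_mul_const]
          refine norm_integral_le_of_norm_le (hf.norm.mul_const _) (ae_of_all _ fun x => ?_)
          rw [norm_mul, mul_comm]
          gcongr
          exact g.norm_coe_le_norm x)
      intro g
      have hle : (Submodule.span ℂ (Set.range (dualContinuousEval (C := C)))) ≤
            LinearMap.ker Φ.toLinearMap := by
        rw [Submodule.span_le]
        rintro _ ⟨c, rfl⟩
        exact h c
      exact Submodule.topologicalClosure_minimal _ hle Φ.isClosed_ker (dualEval_span_dense C g)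
    let : MetricSpace (dualSubgroup C) := TopologicalSpace.metrizableSpaceMetric _
    refine ae_eq_zero_of_forall_setIntegral_isClosed_eq_zero hf fun s hs => ?_
    have hlim : Filter.Tendsto
        (fun n => ∫ χ, (((hs.apprSeq n χ : NNReal) : ℝ) : ℂ) * f χ ∂(dualHaar C)) Filter.atTop
        (nhds (∫ χ, s.indicator f χ ∂(dualHaar C))) := by
      refine tendsto_integral_of_dominated_convergence (fun χ => ‖f χ‖) (fun n => ?_) hf.norm
        (fun n => ae_of_all _ fun χ => ?_) (ae_of_all _ fun χ => ?_)
      · exact (Continuous.aestronglyMeasurable (by fun_prop)).mul hf.aestronglyMeasurable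
      · rw [norm_mul]
        refine mul_le_of_le_one_left (norm_nonneg _) ?_
        simpa using HasOuterApproxClosed.apprSeq_apply_le_one hs n χ
      · have h1 := (tendsto_pi_nhds.1 (HasOuterApproxClosed.tendsto_apprSeq hs)) χ
        have h2 : s.indicator f χ = (((s.indicator (fun _ => (1 : NNReal)) χ : NNReal) : ℝ) : ℂ) * f χ := by
          by_cases hx : χ ∈ s <;> simp [hx]
        rw [h2]
        refine Filter.Tendsto.mul_const _ ?_
        exact (Complex.continuous_ofReal.tendsto _).comp
          ((NNReal.continuous_coe.tendsto _).comp h1)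
    rw [← integral_indicator hs.measurableSet]
    refine tendsto_nhds_unique hlim ?_
    have h0 : ∀ n, ∫ χ, (((hs.apprSeq n χ : NNReal) : ℝ) : ℂ) * f χ ∂(dualHaar C) = 0 :=
      fun n => hcont ⟨fun χ => (((hs.apprSeq n χ : NNReal) : ℝ) : ℂ), by fun_prop⟩
    simp only [h0]
    exact tendsto_const_nhds

end Haar

/-! ### Circle-valued functions as vectors in `L²` -/

namespace CircleMaps

variable {X : Type*} [MeasurableSpace X] (μ : Measure X) [IsFiniteMeasure μ]

theorem memLp (f : CircleMaps X) (p : ℝ≥0∞) : MemLp (fun x => (f.1 x : ℂ)) p μ :=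
  MemLp.of_bound f.2.aestronglyMeasurable 1 (ae_of_all _ fun x => (norm_apply f x).le)

/-- A circle-valued measurable function as a vector in `L²`. -/
noncomputable def toL2 (f : CircleMaps X) : Lp ℂ 2 μ := (memLp μ f 2).toLp

theorem coeFn_toL2 (f : CircleMaps X) : toL2 μ f =ᵐ[μ] fun x => (f.1 x : ℂ) :=
  (memLp μ f 2).coeFn_toLp

theorem inner_toL2_left (f : CircleMaps X) (ψ : Lp ℂ 2 μ) :
    ⟪toL2 μ f, ψ⟫_ℂ = ∫ x, ((f⁻¹ : CircleMaps X).1 x : ℂ) * ψ x ∂μ := by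
  rw [L2.inner_def]
  refine integral_congr_ae ?_
  filter_upwards [coeFn_toL2 μ f] with x hx
  rw [hx, coe_inv_apply, RCLike.inner_apply, mul_comm]

theorem inner_toL2_toL2 (f g : CircleMaps X) :
    ⟪toL2 μ f, toL2 μ g⟫_ℂ = ∫ x, ((f⁻¹ * g : CircleMaps X).1 x : ℂ) ∂μ := by
  rw [inner_toL2_left]
  refine integral_congr_ae ?_
  filter_upwards [coeFn_toL2 μ g] with x hx
  rw [hx, coe_mul_apply]

theorem norm_toL2 [IsProbabilityMeasure μ] (f : CircleMaps X) : ‖toL2 μ f‖ = 1 := by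
  have h : ⟪toL2 μ f, toL2 μ f⟫_ℂ = 1 := by
    rw [inner_toL2_toL2, inv_mul_cancel]
    simp
  rw [norm_eq_sqrt_re_inner (𝕜 := ℂ), h]
  simp

end CircleMaps

/-! ### Fourier models on the unit interval -/

section Interval

theorem IsFourierModel.orthonormal {C X : Type*} [CommGroup C] [MeasurableSpace X]
    {μ : Measure X} [IsProbabilityMeasure μ] {u : C →* CircleMaps X}
    (hu : IsFourierModel μ u) : Orthonormal ℂ fun c => CircleMaps.toL2 μ (u c) := by
  refine ⟨fun c => CircleMaps.norm_toL2 μ _, fun a b hab => ?_⟩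
  change ⟪CircleMaps.toL2 μ (u a), CircleMaps.toL2 μ (u b)⟫_ℂ = 0
  rw [CircleMaps.inner_toL2_toL2, ← map_inv, ← map_mul]
  exact hu.integral_eq_zero _ (fun h => hab (inv_mul_eq_one.1 h))

/-- A Fourier model is transported along a measurable map with an almost everywhere left inverse. -/
theorem IsFourierModel.transport {C X Y : Type*} [CommGroup C] [MeasurableSpace X]
    [MeasurableSpace Y] {μ : Measure X} {u : C →* CircleMaps X} (hu : IsFourierModel μ u)
    {h : X → Y} (hh : Measurable h) {g : Y → X} (hg : Measurable g)
    (hgh : ∀ᵐ x ∂μ, g (h x) = x) :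
    IsFourierModel (μ.map h) ((CircleMaps.comp g hg).comp u) := by
  constructor
  · intro c hc
    rw [integral_map hh.aemeasurable (CircleMaps.measurable_coe _).aestronglyMeasurable,
      ← hu.integral_eq_zero c hc]
    refine integral_congr_ae ?_
    filter_upwards [hgh] with x hx
    change ((u c).1 (g (h x)) : ℂ) = _
    rw [hx]
  · intro f hf hint
    have h1 : (fun x => f (h x)) =ᵐ[μ] 0 := by
      refine hu.ae_eq_zero _ (hf.comp_measurable hh) fun c => ?_
      rw [← hint c]
      refine Eq.trans ?_ (integral_map hh.aemeasurable
        ((CircleMaps.measurable_coe _).aestronglyMeasurable.mul hf.aestronglyMeasurable)).symm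
      refine integral_congr_ae ?_
      filter_upwards [hgh] with x hx
      change _ = ((u c).1 (g (h x)) : ℂ) * f (h x)
      rw [hx]
    have h2 : ∫ y, ‖f y‖ ∂(μ.map h) = 0 := by
      rw [integral_map hh.aemeasurable hf.aestronglyMeasurable.norm]
      refine integral_eq_zero_of_ae ?_
      filter_upwards [h1] with x hx
      simp [hx]
    have h4 := (integral_eq_zero_iff_of_nonneg (fun z => norm_nonneg (f z)) hf.norm).1 h2
    filter_upwards [h4] with z hz
    simpa using hz

/-- The jump of the distribution function at a point is the mass of that point. -/
theorem continuous_cdf_of_noAtoms (m : Measure ℝ) [IsProbabilityMeasure m] [NullSingletonClass m] :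
    Continuous (ProbabilityTheory.cdf m) := by
  refine continuous_iff_continuousAt.2 fun a => ?_
  have h := StieltjesFunction.measure_singleton (ProbabilityTheory.cdf m) a
  rw [ProbabilityTheory.measure_cdf, measure_singleton, eq_comm, ENNReal.ofReal_eq_zero,
    sub_nonpos] at h
  have hm := (ProbabilityTheory.cdf m).mono
  rw [hm.continuousAt_iff_leftLim_eq_rightLim, StieltjesFunction.rightLim_eq]
  exact le_antisymm (hm.leftLim_le le_rfl) h

/-- The cumulative distribution function of an atomless probability measure on the real line maps
it to the uniform distribution. -/
theorem map_cdf_of_noAtoms (m : Measure ℝ) [IsProbabilityMeasure m] [NullSingletonClass m] :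
    m.map (ProbabilityTheory.cdf m) = volume.restrict (Set.Ioc 0 1) := by
  have hcont := continuous_cdf_of_noAtoms m
  have : IsFiniteMeasure (volume.restrict (Set.Ioc (0 : ℝ) 1)) := ⟨by simp⟩
  have hsurj : ∀ b ∈ Set.Ioo (0 : ℝ) 1, ∃ x, ProbabilityTheory.cdf m x = b := by
    intro b hb
    have hlo := (ProbabilityTheory.tendsto_cdf_atBot m).eventually (gt_mem_nhds hb.1)
    have hhi := (ProbabilityTheory.tendsto_cdf_atTop m).eventually (lt_mem_nhds hb.2)
    obtain ⟨x, hx⟩ := hlo.exists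
    obtain ⟨y, hy⟩ := hhi.exists
    exact mem_range_of_exists_le_of_exists_ge hcont ⟨x, hx.le⟩ ⟨y, hy.le⟩
  have hIic : ∀ x, m (Set.Iic x) = ENNReal.ofReal (ProbabilityTheory.cdf m x) := fun x =>
    (ProbabilityTheory.ofReal_cdf m x).symm
  refine Measure.ext_of_Iic _ _ fun a => ?_
  rw [Measure.map_apply hcont.measurable measurableSet_Iic, Measure.restrict_apply measurableSet_Iic]
  have hR : volume (Set.Iic a ∩ Set.Ioc 0 1) = ENNReal.ofReal (min a 1) := by
    have : Set.Iic a ∩ Set.Ioc 0 1 = Set.Ioc 0 (min a 1) := by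
      ext z; simp only [Set.mem_inter_iff, Set.mem_Iic, Set.mem_Ioc, le_min_iff]; tauto
    rw [this, Real.volume_Ioc, sub_zero]
  rw [hR]
  rcases le_or_gt 1 a with h1 | h1
  · have : ProbabilityTheory.cdf m ⁻¹' Set.Iic a = Set.univ := by
      ext x; simpa using (ProbabilityTheory.cdf_le_one m x).trans h1
    rw [this, measure_univ, min_eq_right h1, ENNReal.ofReal_one]
  rw [min_eq_left h1.le]
  refine le_antisymm ?_ ?_
  · rcases lt_or_ge a 0 with h0 | h0
    · have : ProbabilityTheory.cdf m ⁻¹' Set.Iic a = ∅ := by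
        ext x
        simpa using h0.trans_le (ProbabilityTheory.cdf_nonneg m x)
      rw [this]; simp
    -- The distribution function may be constant at level `a`, and `a = 0` need not be attained. So
    -- the preimage is enclosed in a half-line ending at a point of level `b`, with `b` slightly
    -- above `a`.
    refine le_of_forall_gt fun c hc => ?_
    obtain ⟨b, hab, hbc⟩ : ∃ b : ℝ, b ∈ Set.Ioo a 1 ∧ ENNReal.ofReal b < c := by
      rcases eq_or_ne c ⊤ with rfl | hc'
      · exact ⟨(a + 1) / 2, ⟨by linarith, by linarith⟩, ENNReal.ofReal_lt_top⟩
      · have h2 : a < c.toReal := (ENNReal.ofReal_lt_iff_lt_toReal h0 hc').1 hc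
        obtain ⟨b, hb1, hb2⟩ := exists_between (lt_min h2 h1)
        exact ⟨b, ⟨hb1, hb2.trans_le (min_le_right _ _)⟩,
          (ENNReal.ofReal_lt_iff_lt_toReal (h0.trans hb1.le) hc').2 (hb2.trans_le (min_le_left _ _))⟩
    obtain ⟨y, hy⟩ := hsurj b ⟨h0.trans_lt hab.1, hab.2⟩
    refine lt_of_le_of_lt ?_ hbc
    rw [← hy, ← hIic]
    refine measure_mono fun x hx => ?_
    by_contra hxy
    have := (ProbabilityTheory.monotone_cdf m) (not_le.1 hxy).le
    rw [hy] at this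
    exact absurd (this.trans hx) (not_le.2 hab.1)
  · rcases le_or_gt a 0 with h0 | h0
    · simp [ENNReal.ofReal_eq_zero.2 h0]
    obtain ⟨y, hy⟩ := hsurj a ⟨h0, h1⟩
    rw [← hy, ← hIic]
    exact measure_mono fun x hx => (ProbabilityTheory.monotone_cdf m) hx

/-- An atomless standard Borel probability space is isomorphic to the unit interval, up to null
sets. -/
theorem exists_map_eq_uniform {X : Type*} [MeasurableSpace X] [StandardBorelSpace X]
    (μ : Measure X) [IsProbabilityMeasure μ] [NullSingletonClass μ] :
    ∃ (h : X → ℝ) (g : ℝ → X), Measurable h ∧ Measurable g ∧ (∀ᵐ x ∂μ, g (h x) = x) ∧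
      μ.map h = volume.restrict (Set.Ioc 0 1) := by
  obtain ⟨e, he⟩ := exists_measurableEmbedding_real X
  have : IsProbabilityMeasure (μ.map e) := Measure.isProbabilityMeasure_map he.measurable.aemeasurable
  have : NullSingletonClass (μ.map e) := ⟨fun a => by
    rw [Measure.map_apply he.measurable (measurableSet_singleton a)]
    exact (Set.subsingleton_singleton.preimage he.injective).measure_zero μ⟩
  set F := ProbabilityTheory.cdf (μ.map e) with hF
  have hFm : Measurable F := (continuous_cdf_of_noAtoms _).measurable
  have hmap := map_cdf_of_noAtoms (μ.map e)
  rw [Measure.map_map hFm he.measurable] at hmap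
  -- If `F` takes the same value at two points `e x < e y`, it is constant between them and this
  -- value is `F q` for a rational `q`. Removing these countably many levels makes `F ∘ e`
  -- injective. Each removed level is null because the image measure is Lebesgue measure.
  let S : Set X := ⋂ q : ℚ, {x | F (e x) = F q}ᶜ
  have hSm : MeasurableSet S := MeasurableSet.iInter fun q =>
    ((hFm.comp he.measurable) (measurableSet_singleton (F q))).compl
  have hSae : ∀ᵐ x ∂μ, x ∈ S := by
    simp only [S, Set.mem_iInter]
    refine ae_all_iff.2 fun q => ?_
    change μ {x | ¬ _} = 0
    have h0 : (μ.map (F ∘ e)) {F q} = 0 := by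
      rw [hmap]
      simp
    rw [Measure.map_apply (hFm.comp he.measurable) (measurableSet_singleton _)] at h0
    convert h0 using 2
    ext x; simp
  have hinj : Set.InjOn (F ∘ e) S := by
    have key : ∀ x ∈ S, ∀ y ∈ S, F (e x) = F (e y) → ¬ e x < e y := by
      intro x hx y hy hxy hlt
      obtain ⟨q, hq1, hq2⟩ := exists_rat_btwn hlt
      have h1 := (ProbabilityTheory.monotone_cdf (μ.map e)) hq1.le
      have h2 := (ProbabilityTheory.monotone_cdf (μ.map e)) hq2.le
      have := Set.mem_iInter.1 hx q
      exact this (le_antisymm h1 (h2.trans_eq hxy.symm))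
    intro x hx y hy hxy
    rcases lt_trichotomy (e x) (e y) with h | h | h
    · exact absurd h (key x hx y hy hxy)
    · exact he.injective h
    · exact absurd h (key y hy x hx hxy.symm)
  have : StandardBorelSpace S := hSm.standardBorel
  have hemb : MeasurableEmbedding (fun x : S => F (e x)) :=
    ((hFm.comp he.measurable).comp measurable_subtype_coe).measurableEmbedding
      (fun x y h => Subtype.ext (hinj x.2 y.2 h))
  obtain ⟨x₀⟩ : Nonempty X := nonempty_of_isProbabilityMeasure μ
  obtain ⟨g, hg, hgF⟩ := hemb.exists_measurable_extend measurable_subtype_coe (fun _ => ⟨x₀⟩)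
  refine ⟨F ∘ e, g, hFm.comp he.measurable, hg, ?_, hmap⟩
  filter_upwards [hSae] with x hx
  exact congrFun hgF ⟨x, hx⟩

/-- A probability space with a Fourier model of an infinite group has no atoms. -/
theorem IsFourierModel.noAtoms {C X : Type*} [CommGroup C] [Infinite C] [MeasurableSpace X]
    [MeasurableSingletonClass X] {μ : Measure X} [IsProbabilityMeasure μ] {u : C →* CircleMaps X}
    (hu : IsFourierModel μ u) : NullSingletonClass μ := by
  refine ⟨fun x => by_contra fun hx => ?_⟩
  have hne : μ {x} ≠ ⊤ := measure_ne_top _ _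
  set ψ := indicatorConstLp (μ := μ) 2 (measurableSet_singleton x) hne (1 : ℂ)
  -- The indicator of an atom has Fourier coefficients of the same modulus at every `c`. With
  -- infinitely many `c` this contradicts Bessel's inequality.
  have hin : ∀ c, ‖⟪CircleMaps.toL2 μ (u c), ψ⟫_ℂ‖ = μ.real {x} := by
    intro c
    rw [← norm_inner_symm, L2.inner_indicatorConstLp_one,
      setIntegral_congr_ae (g := fun y => ((u c).1 y : ℂ)) (measurableSet_singleton x)
        ((CircleMaps.coeFn_toL2 μ (u c)).mono fun y hy _ => hy), integral_singleton, norm_smul,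
      CircleMaps.norm_apply, mul_one, Real.norm_of_nonneg measureReal_nonneg]
  have hpos : 0 < μ.real {x} := ENNReal.toReal_pos hx hne
  obtain ⟨n, hn⟩ := exists_nat_gt (‖ψ‖ ^ 2 / μ.real {x} ^ 2)
  obtain ⟨s, hs⟩ := Infinite.exists_subset_card_eq C n
  have h := hu.orthonormal.sum_inner_products_le ψ (s := s)
  simp only [hin, Finset.sum_const, hs, nsmul_eq_mul] at h
  rw [div_lt_iff₀ (by positivity)] at hn
  linarith

/-- An infinite countable abelian group has a Fourier model on the unit interval. -/
theorem exists_isFourierModel_uniform (C : Type*) [CommGroup C] [Countable C] [Infinite C] :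
    ∃ u : C →* CircleMaps ℝ, IsFourierModel (volume.restrict (Set.Ioc 0 1)) u := by
  have hu := isFourierModel_dualEval C
  have := hu.noAtoms
  obtain ⟨h, g, hh, hg, hgh, hmap⟩ := exists_map_eq_uniform (dualHaar C)
  rw [← hmap]
  exact ⟨_, hu.transport hh hg hgh⟩

end Interval

/-! ### Canonical bases and the regular representation -/

namespace Ell2

/-- The canonical Hilbert basis of `ℓ²(X)`. -/
noncomputable def basis (X : Type*) : HilbertBasis X ℂ (Ell2 X) :=
  ⟨LinearIsometryEquiv.refl ℂ _⟩

/-- The vector of `ℓ²(X)` supported at a point. -/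
noncomputable def delta {X : Type*} (x : X) : Ell2 X := basis X x

theorem inner_delta_left {X : Type*} (x : X) (ξ : Ell2 X) : ⟪delta x, ξ⟫_ℂ = ξ x :=
  ((basis X).repr_apply_apply ξ x).symm

theorem orthonormal_delta (X : Type*) : Orthonormal ℂ (delta : X → Ell2 X) :=
  (basis X).orthonormal

theorem dense_span_delta (X : Type*) :
    Dense (Submodule.span ℂ (Set.range (delta : X → Ell2 X)) : Set (Ell2 X)) :=
  Submodule.dense_iff_topologicalClosure_eq_top.2 (basis X).dense_span

open Classical in
theorem delta_apply {X : Type*} (x y : X) : delta x y = if y = x then 1 else 0 := by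
  rw [← inner_delta_left]
  exact orthonormal_iff_ite.1 (orthonormal_delta X) y x

theorem ext_delta {X E : Type*} [NormedAddCommGroup E] [NormedSpace ℂ E] {S T : Ell2 X →L[ℂ] E}
    (h : ∀ x, S (delta x) = T (delta x)) : S = T :=
  ContinuousLinearMap.ext_on (dense_span_delta X) (by rintro _ ⟨x, rfl⟩; exact h x)

end Ell2

open Ell2

section Isometry

variable {X E : Type*} [NormedAddCommGroup E] [InnerProductSpace ℂ E] [CompleteSpace E]

/-- The isometry that maps the canonical basis of `ℓ²(X)` to a given orthonormal family. -/
noncomputable def Orthonormal.ell2Isometry {v : X → E} (hv : Orthonormal ℂ v) :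
    Ell2 X →ₗᵢ[ℂ] E :=
  hv.orthogonalFamily.linearIsometry

@[simp] theorem Orthonormal.ell2Isometry_delta {v : X → E} (hv : Orthonormal ℂ v) (x : X) :
    hv.ell2Isometry (delta x) = v x := by
  classical
  have h : delta x = lp.single 2 x (1 : ℂ) := by
    rw [delta, ← (basis X).repr_symm_single]; rfl
  rw [h, Orthonormal.ell2Isometry, OrthogonalFamily.linearIsometry_apply_single]
  simp

/-- The unitary that maps the canonical basis of `ℓ²(X)` to a given orthonormal basis. -/
noncomputable def Orthonormal.ell2Equiv {v : X → E} (hv : Orthonormal ℂ v)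
    (hd : Dense (Submodule.span ℂ (Set.range v) : Set E)) : Ell2 X ≃ₗᵢ[ℂ] E :=
  (HilbertBasis.mk hv (Submodule.dense_iff_topologicalClosure_eq_top.1 hd).ge).repr.symm

@[simp] theorem Orthonormal.ell2Equiv_delta {v : X → E} (hv : Orthonormal ℂ v)
    (hd : Dense (Submodule.span ℂ (Set.range v) : Set E)) (x : X) :
    hv.ell2Equiv hd (delta x) = v x := by
  classical
  have h : delta x = lp.single 2 x (1 : ℂ) := by
    rw [delta, ← (basis X).repr_symm_single]; rfl
  rw [h, Orthonormal.ell2Equiv, HilbertBasis.repr_symm_single, HilbertBasis.coe_mk]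

end Isometry

theorem leftRegular_apply {G : Type*} [Group G] (g : G) (ξ : Ell2 G) (h : G) :
    leftRegular G g ξ h = ξ (g⁻¹ * h) := rfl

@[simp] theorem leftRegular_delta {G : Type*} [Group G] (g h : G) :
    leftRegular G g (delta h) = delta (g * h) := by
  classical
  ext k
  rw [leftRegular_apply, delta_apply, delta_apply]
  simp only [inv_mul_eq_iff_eq_mul]

theorem leftRegular_mul {G : Type*} [Group G] (g h : G) :
    leftRegular G (g * h) = leftRegular G g * leftRegular G h :=
  ext_delta fun k => by simp [mul_assoc]

theorem leftRegular_one {G : Type*} [Group G] : leftRegular G 1 = 1 :=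
  ext_delta fun k => by simp

/-! ### Multiplication operators and density of Fourier models -/

section Multiplication

variable {X : Type*} [MeasurableSpace X] (μ : Measure X) [IsProbabilityMeasure μ]

omit [IsProbabilityMeasure μ] in
theorem CircleMaps.memLp_mul (f : CircleMaps X) (ψ : Lp ℂ 2 μ) :
    MemLp (fun x => (f.1 x : ℂ) * ψ x) 2 μ :=
  (Lp.memLp ψ).of_le (f.2.aestronglyMeasurable.mul (Lp.aestronglyMeasurable ψ))
    (ae_of_all _ fun x => by
      change ‖(f.1 x : ℂ) * ψ x‖ ≤ _
      rw [norm_mul, norm_apply, one_mul])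

/-- Multiplication by a circle-valued measurable function, on `L²`. -/
noncomputable def CircleMaps.mulL2 (f : CircleMaps X) : Lp ℂ 2 μ →ₗᵢ[ℂ] Lp ℂ 2 μ where
  toFun ψ := (memLp_mul μ f ψ).toLp
  map_add' ψ φ := by
    rw [← MemLp.toLp_add]
    refine (MemLp.toLp_eq_toLp_iff _ _).2 ?_
    filter_upwards [Lp.coeFn_add ψ φ] with x hx
    rw [hx, Pi.add_apply, Pi.add_apply, mul_add]
  map_smul' r ψ := by
    rw [RingHom.id_apply, ← MemLp.toLp_const_smul]
    refine (MemLp.toLp_eq_toLp_iff _ _).2 ?_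
    filter_upwards [Lp.coeFn_smul r ψ] with x hx
    rw [hx, Pi.smul_apply, Pi.smul_apply, smul_eq_mul, smul_eq_mul, mul_left_comm]
  norm_map' ψ := by
    simp only [LinearMap.coe_mk, AddHom.coe_mk]
    rw [Lp.norm_toLp, Lp.norm_def]
    congr 1
    exact eLpNorm_congr_norm_ae (ae_of_all _ fun x => by rw [norm_mul, norm_apply, one_mul])

theorem CircleMaps.mulL2_toL2 (f g : CircleMaps X) :
    mulL2 μ f (toL2 μ g) = toL2 μ (f * g) := by
  refine (MemLp.toLp_eq_toLp_iff (memLp_mul μ f _) (memLp μ _ 2)).2 ?_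
  filter_upwards [coeFn_toL2 μ g] with x hx
  rw [hx, coe_mul_apply]

variable {μ}

/-- If `ψ` is orthogonal to all the vectors `u c * f`, then `f⁻¹ ψ` has only zero coefficients. The
factor `f` is there because the new group meets each coset in such a translated model. -/
theorem IsFourierModel.dense_span_mul {C : Type*} [CommGroup C] {u : C →* CircleMaps X}
    (hu : IsFourierModel μ u) (f : CircleMaps X) :
    Dense (Submodule.span ℂ (Set.range fun c => CircleMaps.toL2 μ (u c * f)) :
      Set (Lp ℂ 2 μ)) := by
  rw [Submodule.dense_iff_topologicalClosure_eq_top, Submodule.topologicalClosure_eq_top_iff,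
    Submodule.eq_bot_iff]
  intro ψ hψ
  have hint : Integrable (fun x => ψ x) μ :=
    (Lp.memLp ψ).integrable (by norm_num)
  have h := hu.ae_eq_zero (fun x => ((f⁻¹ : CircleMaps X).1 x : ℂ) * ψ x)
    (CircleMaps.integrable_mul _ hint) fun c => by
      have h1 := (Submodule.mem_orthogonal _ _).1 hψ _ (Submodule.subset_span ⟨c⁻¹, rfl⟩)
      rw [CircleMaps.inner_toL2_left] at h1
      rw [← h1]
      refine integral_congr_ae (ae_of_all _ fun x => ?_)
      simp only [map_inv, mul_inv, inv_inv, CircleMaps.coe_mul_apply, mul_assoc]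
  refine Lp.ext ?_
  filter_upwards [h, Lp.coeFn_zero ℂ 2 μ] with x hx hx0
  rw [hx0]
  refine (mul_eq_zero.1 hx).resolve_left fun h0 => ?_
  have := CircleMaps.norm_apply f⁻¹ x
  rw [h0, norm_zero] at this
  exact zero_ne_one this

theorem IsFourierModel.dense_span {C : Type*} [CommGroup C] {u : C →* CircleMaps X}
    (hu : IsFourierModel μ u) :
    Dense (Submodule.span ℂ (Set.range fun c => CircleMaps.toL2 μ (u c)) : Set (Lp ℂ 2 μ)) := by
  simpa using hu.dense_span_mul 1

theorem IsFourierModel.ext_toL2 {C E : Type*} [CommGroup C] {u : C →* CircleMaps X}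
    (hu : IsFourierModel μ u) [NormedAddCommGroup E] [NormedSpace ℂ E] {S T : Lp ℂ 2 μ →L[ℂ] E}
    (h : ∀ c, S (CircleMaps.toL2 μ (u c)) = T (CircleMaps.toL2 μ (u c))) (ψ : Lp ℂ 2 μ) :
    S ψ = T ψ :=
  DFunLike.congr_fun
    (ContinuousLinearMap.ext_on hu.dense_span (by rintro _ ⟨c, rfl⟩; exact h c)) ψ

end Multiplication

/-! ### Functions of the central subgroup acting on `ℓ²(Γ)` -/

section CentralOperators

variable {C Γ X : Type*} [CommGroup C] [Group Γ] [MeasurableSpace X] {μ : Measure X}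
  [IsProbabilityMeasure μ] {u : C →* CircleMaps X} (hu : IsFourierModel μ u) {i : C →* Γ}
  (hi : Function.Injective i)

theorem orthonormal_delta_coset (hi : Function.Injective i) (h : Γ) :
    Orthonormal ℂ fun c => delta (i c * h) :=
  (orthonormal_delta Γ).comp _ fun _ _ hab => hi (mul_right_cancel hab)

/-- The isometry `L²(X) → ℓ²(Γ)` that maps `u c` to `δ (i c * h)`. -/
noncomputable def cosetIsometry (h : Γ) : Lp ℂ 2 μ →ₗᵢ[ℂ] Ell2 Γ :=
  (orthonormal_delta_coset hi h).ell2Isometry.comp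
    (hu.orthonormal.ell2Equiv hu.dense_span).symm.toLinearIsometry

@[simp] theorem cosetIsometry_toL2 (h : Γ) (c : C) :
    cosetIsometry hu hi h (CircleMaps.toL2 μ (u c)) = delta (i c * h) := by
  have : (hu.orthonormal.ell2Equiv hu.dense_span).symm (CircleMaps.toL2 μ (u c)) = delta c := by
    rw [LinearIsometryEquiv.symm_apply_eq, Orthonormal.ell2Equiv_delta]
  change (orthonormal_delta_coset hi h).ell2Isometry
    ((hu.orthonormal.ell2Equiv hu.dense_span).symm _) = _
  rw [this, Orthonormal.ell2Isometry_delta]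

/-- A change of base point within a coset of the central subgroup amounts to multiplication by `u
c`. -/
theorem cosetIsometry_mul (c : C) (h : Γ) (ψ : Lp ℂ 2 μ) :
    cosetIsometry hu hi (i c * h) ψ = cosetIsometry hu hi h (CircleMaps.mulL2 μ (u c) ψ) :=
  hu.ext_toL2 (S := (cosetIsometry hu hi (i c * h)).toContinuousLinearMap)
    (T := ((cosetIsometry hu hi h).comp (CircleMaps.mulL2 μ (u c))).toContinuousLinearMap)
    (fun c' => by
      change cosetIsometry hu hi (i c * h) _ = cosetIsometry hu hi h (CircleMaps.mulL2 μ (u c) _)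
      rw [CircleMaps.mulL2_toL2, ← map_mul, cosetIsometry_toL2, cosetIsometry_toL2, mul_comm c,
        map_mul, mul_assoc]) ψ

theorem inner_cosetIsometry_eq_zero {h k : Γ} (hk : ∀ c, h ≠ i c * k) (ψ φ : Lp ℂ 2 μ) :
    ⟪cosetIsometry hu hi h ψ, cosetIsometry hu hi k φ⟫_ℂ = 0 := by
  have h1 : ∀ c φ, ⟪delta (i c * h), cosetIsometry hu hi k φ⟫_ℂ = 0 := fun c φ =>
    hu.ext_toL2 (S := (innerSL ℂ (delta (i c * h))).comp
      (cosetIsometry hu hi k).toContinuousLinearMap) (T := 0) (fun c' => by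
        change ⟪delta (i c * h), cosetIsometry hu hi k _⟫_ℂ = 0
        rw [cosetIsometry_toL2]
        refine (orthonormal_delta Γ).2 fun heq => hk (c⁻¹ * c') ?_
        rw [map_mul, mul_assoc, ← heq, map_inv, inv_mul_cancel_left]) φ
  rw [← inner_conj_symm, map_eq_zero]
  exact hu.ext_toL2 (S := (innerSL ℂ (cosetIsometry hu hi k φ)).comp
    (cosetIsometry hu hi h).toContinuousLinearMap) (T := 0) (fun c => by
      change ⟪cosetIsometry hu hi k φ, cosetIsometry hu hi h _⟫_ℂ = 0
      rw [cosetIsometry_toL2, ← inner_conj_symm, h1, map_zero]) ψ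

/-- For `h` and `k` in one coset the factor `f` cancels, and the inner product is the integral of
some `u c`, zero for `c ≠ 1`. Different cosets have orthogonal supports. -/
theorem orthonormal_cosetIsometry (f : CircleMaps X) :
    Orthonormal ℂ fun h : Γ => cosetIsometry hu hi h (CircleMaps.toL2 μ f) := by
  refine ⟨fun h => ?_, fun h k hhk => ?_⟩
  · rw [LinearIsometry.norm_map, CircleMaps.norm_toL2]
  · change ⟪cosetIsometry hu hi h _, cosetIsometry hu hi k _⟫_ℂ = 0
    by_cases hex : ∃ c, h = i c * k
    · obtain ⟨c, rfl⟩ := hex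
      rw [cosetIsometry_mul, LinearIsometry.inner_map_map, CircleMaps.mulL2_toL2,
        CircleMaps.inner_toL2_toL2, mul_inv, inv_mul_cancel_right, ← map_inv]
      refine hu.integral_eq_zero _ fun hc => hhk ?_
      rw [inv_eq_one.1 hc, map_one, one_mul]
    · exact inner_cosetIsometry_eq_zero hu hi (not_exists.1 hex) _ _

/-- The operator on `ℓ²(Γ)` given by a circle-valued measurable function `f`, where the central
subgroup `i C` acts through `u`. -/
noncomputable def centralOp (f : CircleMaps X) : Ell2 Γ →L[ℂ] Ell2 Γ :=
  (orthonormal_cosetIsometry hu hi f).ell2Isometry.toContinuousLinearMap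

@[simp] theorem centralOp_delta (f : CircleMaps X) (h : Γ) :
    centralOp hu hi f (delta h) = cosetIsometry hu hi h (CircleMaps.toL2 μ f) :=
  (orthonormal_cosetIsometry hu hi f).ell2Isometry_delta h

theorem inner_centralOp (f : CircleMaps X) (ξ η : Ell2 Γ) :
    ⟪centralOp hu hi f ξ, centralOp hu hi f η⟫_ℂ = ⟪ξ, η⟫_ℂ :=
  LinearIsometry.inner_map_map _ _ _

theorem centralOp_cosetIsometry (f : CircleMaps X) (h : Γ) (ψ : Lp ℂ 2 μ) :
    centralOp hu hi f (cosetIsometry hu hi h ψ) =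
      cosetIsometry hu hi h (CircleMaps.mulL2 μ f ψ) :=
  hu.ext_toL2 (S := (centralOp hu hi f).comp (cosetIsometry hu hi h).toContinuousLinearMap)
    (T := ((cosetIsometry hu hi h).comp (CircleMaps.mulL2 μ f)).toContinuousLinearMap)
    (fun c => by
      change centralOp hu hi f (cosetIsometry hu hi h _) =
        cosetIsometry hu hi h (CircleMaps.mulL2 μ f _)
      rw [cosetIsometry_toL2, centralOp_delta, cosetIsometry_mul, CircleMaps.mulL2_toL2,
        CircleMaps.mulL2_toL2, mul_comm]) ψ

theorem centralOp_mul (f g : CircleMaps X) :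
    centralOp hu hi (f * g) = centralOp hu hi f * centralOp hu hi g :=
  ext_delta fun h => by
    rw [mul_apply_eq_comp, centralOp_delta, centralOp_delta, centralOp_cosetIsometry,
      CircleMaps.mulL2_toL2]

theorem centralOp_model (c : C) : centralOp hu hi (u c) = leftRegular Γ (i c) :=
  ext_delta fun h => by simp

theorem centralOp_one : centralOp hu hi 1 = 1 := by
  rw [← map_one u, centralOp_model, map_one, leftRegular_one]

variable (hc : ∀ c g, i c * g = g * i c)
include hc

theorem leftRegular_cosetIsometry (g h : Γ) (ψ : Lp ℂ 2 μ) :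
    leftRegular Γ g (cosetIsometry hu hi h ψ) = cosetIsometry hu hi (g * h) ψ :=
  hu.ext_toL2 (S := (leftRegular Γ g).comp (cosetIsometry hu hi h).toContinuousLinearMap)
    (T := (cosetIsometry hu hi (g * h)).toContinuousLinearMap)
    (fun c => by
      change leftRegular Γ g (cosetIsometry hu hi h _) = cosetIsometry hu hi (g * h) _
      rw [cosetIsometry_toL2, cosetIsometry_toL2, leftRegular_delta, ← mul_assoc, ← mul_assoc,
        hc]) ψ

omit hc in
/-- An operator that commutes with the operators of a Fourier model commutes with the operators of
all circle-valued measurable functions. -/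
theorem commute_centralOp {D : Type*} [CommGroup D] {π : D →* CircleMaps X}
    (hπ : IsFourierModel μ π) {S : Ell2 Γ →L[ℂ] Ell2 Γ}
    (hS : ∀ d, Commute S (centralOp hu hi (π d))) (f : CircleMaps X) :
    Commute S (centralOp hu hi f) := by
  refine ext_delta fun h => ?_
  rw [mul_apply_eq_comp, mul_apply_eq_comp, centralOp_delta]
  refine lp.ext (funext fun k => ?_)
  rw [← inner_delta_left, ← inner_delta_left]
  -- The matrix coefficients of `S f` and of `f S` at `h`, `k` are both bounded linear functionals
  -- of `f` in `L²(X)`; the second one is represented by the conjugate of `ζ`. They agree on the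
  -- total set of all `π d`, hence everywhere.
  set ζ : Lp ℂ 2 μ :=
    ContinuousLinearMap.adjoint (cosetIsometry hu hi k).toContinuousLinearMap (S (delta h))
  have hζ : MemLp (fun x => conj (ζ x)) 2 μ := (Lp.memLp ζ).star
  have key : ∀ g : CircleMaps X,
      ⟪delta k, centralOp hu hi g (S (delta h))⟫_ℂ = ⟪hζ.toLp, CircleMaps.toL2 μ g⟫_ℂ := by
    intro g
    have h1 : delta k = centralOp hu hi g (cosetIsometry hu hi k (CircleMaps.toL2 μ g⁻¹)) := by
      rw [← centralOp_delta, ← mul_apply_eq_comp, ← centralOp_mul, mul_inv_cancel,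
        centralOp_one, one_apply_eq_self]
    rw [h1, inner_centralOp]
    have h2 : ⟪cosetIsometry hu hi k (CircleMaps.toL2 μ g⁻¹), S (delta h)⟫_ℂ =
        ⟪CircleMaps.toL2 μ g⁻¹, ζ⟫_ℂ :=
      (ContinuousLinearMap.adjoint_inner_right
        (cosetIsometry hu hi k).toContinuousLinearMap _ _).symm
    rw [h2, CircleMaps.inner_toL2_left, inv_inv, L2.inner_def]
    refine integral_congr_ae ?_
    filter_upwards [CircleMaps.coeFn_toL2 μ g, hζ.coeFn_toLp] with x hx hx'
    rw [hx, hx', RCLike.inner_apply, RingHomCompTriple.comp_apply, RingHom.id_apply]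
  rw [key]
  refine hπ.ext_toL2 (S := (innerSL ℂ (delta k)).comp
    (S.comp (cosetIsometry hu hi h).toContinuousLinearMap)) (T := innerSL ℂ hζ.toLp) (fun d => ?_) _
  change ⟪delta k, S (cosetIsometry hu hi h _)⟫_ℂ = ⟪hζ.toLp, _⟫_ℂ
  rw [← key, ← centralOp_delta, ← mul_apply_eq_comp, (hS d).eq,
    mul_apply_eq_comp]

end CentralOperators

/-! ### Isomorphisms of group von Neumann algebras -/

section GroupVN

variable {G : Type*} [Group G]

theorem star_leftRegular (g : G) : star (leftRegular G g) = leftRegular G g⁻¹ := by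
  classical
  refine ext_delta fun h => lp.ext (funext fun k => ?_)
  rw [← inner_delta_left, ← inner_delta_left, ContinuousLinearMap.star_eq_adjoint,
    ContinuousLinearMap.adjoint_inner_right, leftRegular_delta, leftRegular_delta,
    inner_delta_left, inner_delta_left, delta_apply, delta_apply]
  simp only [eq_inv_mul_iff_mul_eq]

/-- The generators are closed under adjoints, hence so is their commutant, and the conditions on
adjoints in `StarSubalgebra.centralizer` are redundant. -/
theorem mem_groupVN_iff {a : Ell2 G →L[ℂ] Ell2 G} : a ∈ (groupVN G).toStarSubalgebra ↔
    ∀ S : Ell2 G →L[ℂ] Ell2 G, (∀ g, Commute S (leftRegular G g)) → Commute S a := by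
  have hcent : ∀ S : Ell2 G →L[ℂ] Ell2 G,
      S ∈ StarSubalgebra.centralizer ℂ (Set.range (leftRegular G)) ↔
        ∀ g, Commute S (leftRegular G g) := by
    intro S
    rw [StarSubalgebra.mem_centralizer_iff]
    constructor
    · exact fun h g => (h _ ⟨g, rfl⟩).1.symm
    · rintro h _ ⟨g, rfl⟩
      exact ⟨(h g).eq.symm, by rw [star_leftRegular]; exact (h g⁻¹).eq.symm⟩
  change a ∈ StarSubalgebra.centralizer ℂ (StarSubalgebra.centralizer ℂ
    (Set.range (leftRegular G)) : Set (Ell2 G →L[ℂ] Ell2 G)) ↔ _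
  rw [StarSubalgebra.mem_centralizer_iff]
  constructor
  · exact fun h S hS => (h S ((hcent S).2 hS)).1
  · intro h S hS
    exact ⟨h S ((hcent S).1 hS), h (star S) ((hcent _).1 (star_mem hS))⟩

variable {Λ Γ : Type*} [Group Λ] [Group Γ]

/-- A unitary intertwines two group von Neumann algebras if the images of the generators of the
first one have the same commutant as the generators of the second one. -/
def IntertwinesGroupVN (W : Ell2 Λ ≃ₗᵢ[ℂ] Ell2 Γ) : Prop :=
  ∀ S : Ell2 Γ →L[ℂ] Ell2 Γ, (∀ g, Commute S (leftRegular Γ g)) ↔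
    ∀ x, Commute S (W.conjStarAlgEquiv (leftRegular Λ x))

theorem IntertwinesGroupVN.mem_iff {W : Ell2 Λ ≃ₗᵢ[ℂ] Ell2 Γ} (hW : IntertwinesGroupVN W)
    (a : Ell2 Λ →L[ℂ] Ell2 Λ) :
    W.conjStarAlgEquiv a ∈ (groupVN Γ).toStarSubalgebra ↔ a ∈ (groupVN Λ).toStarSubalgebra := by
  rw [mem_groupVN_iff, mem_groupVN_iff]
  have hcomm : ∀ S b : Ell2 Λ →L[ℂ] Ell2 Λ,
      Commute (W.conjStarAlgEquiv S) (W.conjStarAlgEquiv b) ↔ Commute S b := by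
    intro S b
    simp only [commute_iff_eq, ← map_mul, EmbeddingLike.apply_eq_iff_eq]
  constructor
  · intro h S hS
    exact (hcomm S a).1 (h _ ((hW _).2 fun x => (hcomm _ _).2 (hS x)))
  · intro h S hS
    obtain ⟨S, rfl⟩ := W.conjStarAlgEquiv.surjective S
    exact (hcomm S a).2 (h S fun x => (hcomm _ _).1 ((hW _).1 hS x))

/-- The isomorphism of group von Neumann algebras given by an intertwining unitary. -/
noncomputable def IntertwinesGroupVN.equiv {W : Ell2 Λ ≃ₗᵢ[ℂ] Ell2 Γ}
    (hW : IntertwinesGroupVN W) : LvN Λ ≃⋆ₐ[ℂ] LvN Γ where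
  toFun a := ⟨W.conjStarAlgEquiv a.1, (hW.mem_iff a.1).2 a.2⟩
  invFun b := ⟨W.conjStarAlgEquiv.symm b.1, by
    rw [← hW.mem_iff, StarAlgEquiv.apply_symm_apply]; exact b.2⟩
  left_inv a := Subtype.ext (StarAlgEquiv.symm_apply_apply _ _)
  right_inv b := Subtype.ext (StarAlgEquiv.apply_symm_apply _ _)
  map_mul' a b := Subtype.ext (map_mul W.conjStarAlgEquiv _ _)
  map_add' a b := Subtype.ext (map_add W.conjStarAlgEquiv _ _)
  map_star' a := Subtype.ext (map_star W.conjStarAlgEquiv _)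
  map_smul' r a := Subtype.ext (map_smul W.conjStarAlgEquiv _ _)

end GroupVN

/-- Let `u : C → CircleMaps X` and `π : D → CircleMaps X` be Fourier models, `C` a central subgroup
of `Γ` and `D` a subgroup of `Λ`. If the map `x ↦ F x * s x`, for `F x` a circle-valued measurable
function and `s x ∈ Γ`, is multiplicative on `Λ`, restricts to `π` on `D`, and is bijective modulo
`C` and `D`, then `L(Λ)` and `L(Γ)` are isomorphic by means of a unitary. -/
theorem exists_intertwinesGroupVN {C D Γ Λ X : Type*} [CommGroup C] [CommGroup D] [Group Γ]
    [Group Λ] [MeasurableSpace X] {μ : Measure X} [IsProbabilityMeasure μ]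
    {u : C →* CircleMaps X} (hu : IsFourierModel μ u)
    {π : D →* CircleMaps X} (hπ : IsFourierModel μ π)
    {i : C →* Γ} (hi : Function.Injective i) (hc : ∀ c g, i c * g = g * i c) (j : D → Λ)
    (F : Λ → CircleMaps X) (s : Λ → Γ)
    (hmul : ∀ x y, ∃ c, s x * s y = i c * s (x * y) ∧ F x * F y * u c = F (x * y))
    (hjF : ∀ d x, F (j d * x) = π d * F x) (hjs : ∀ d x, s (j d * x) = s x) (hj1 : j 1 = 1)
    (hs : ∀ x y c, s x = i c * s y → ∃ d, x = j d * y)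
    (hsurj : ∀ γ, ∃ x c, γ = i c * s x) :
    ∃ W : Ell2 Λ ≃ₗᵢ[ℂ] Ell2 Γ, IntertwinesGroupVN W := by
  -- `v x` is the image of `delta 1` under the operator `R x` below. An orthonormal basis of this
  -- form turns `R` into the left regular representation of `Λ`.
  let v : Λ → Ell2 Γ := fun x => cosetIsometry hu hi (s x) (CircleMaps.toL2 μ (F x))
  have hv : Orthonormal ℂ v := by
    refine ⟨fun x => ?_, fun x y hxy => ?_⟩
    · rw [LinearIsometry.norm_map, CircleMaps.norm_toL2]
    · change ⟪cosetIsometry hu hi (s x) _, cosetIsometry hu hi (s y) _⟫_ℂ = 0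
      by_cases hex : ∃ c, s x = i c * s y
      · obtain ⟨c, hcx⟩ := hex
        obtain ⟨d, rfl⟩ := hs x y c hcx
        rw [hjs, LinearIsometry.inner_map_map, hjF, CircleMaps.inner_toL2_toL2, mul_inv,
          inv_mul_cancel_right, ← map_inv]
        refine hπ.integral_eq_zero _ fun hd => hxy ?_
        rw [inv_eq_one.1 hd, hj1, one_mul]
      · exact inner_cosetIsometry_eq_zero hu hi (not_exists.1 hex) _ _
  -- For fixed `x` the vectors `v (j d * x)` come from the functions `π d * F x`, which are total in
  -- `L²(X)`. So the closed span contains everything supported on the coset of `s x`.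
  have hd : Dense (Submodule.span ℂ (Set.range v) : Set (Ell2 Γ)) := by
    rw [Submodule.dense_iff_topologicalClosure_eq_top, eq_top_iff]
    rw [← Submodule.dense_iff_topologicalClosure_eq_top.1 (dense_span_delta Γ)]
    refine Submodule.topologicalClosure_minimal _ (Submodule.span_le.2 ?_)
      (Submodule.isClosed_topologicalClosure _)
    rintro _ ⟨γ, rfl⟩
    obtain ⟨x, c, rfl⟩ := hsurj γ
    have hmem : ∀ ψ, cosetIsometry hu hi (s x) ψ ∈
        (Submodule.span ℂ (Set.range v)).topologicalClosure := by
      intro ψ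
      have hψ : ψ ∈ (Submodule.span ℂ (Set.range fun d =>
          CircleMaps.toL2 μ (π d * F x))).topologicalClosure := by
        rw [Submodule.dense_iff_topologicalClosure_eq_top.1 (hπ.dense_span_mul (F x))]
        trivial
      have hle : Submodule.span ℂ (Set.range fun d => CircleMaps.toL2 μ (π d * F x)) ≤
          (Submodule.span ℂ (Set.range v)).topologicalClosure.comap
            (cosetIsometry hu hi (s x)).toLinearMap := by
        rw [Submodule.span_le]
        rintro _ ⟨d, rfl⟩
        refine Submodule.le_topologicalClosure _ (Submodule.subset_span ⟨j d * x, ?_⟩)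
        change cosetIsometry hu hi (s (j d * x)) (CircleMaps.toL2 μ (F (j d * x))) =
          cosetIsometry hu hi (s x) _
        rw [hjs, hjF]
      exact Submodule.topologicalClosure_minimal _ hle
        ((Submodule.isClosed_topologicalClosure _).preimage
          (cosetIsometry hu hi (s x)).continuous) hψ
    rw [← cosetIsometry_toL2 hu hi (s x) c]
    exact hmem _
  let W := hv.ell2Equiv hd
  let R : Λ → Ell2 Γ →L[ℂ] Ell2 Γ := fun x => centralOp hu hi (F x) * leftRegular Γ (s x)
  have hconj : ∀ x, W.conjStarAlgEquiv (leftRegular Λ x) = R x := by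
    intro x
    have h1 : (W.conjStarAlgEquiv (leftRegular Λ x)).comp
        (W.toContinuousLinearEquiv.toContinuousLinearMap) =
        (R x).comp (W.toContinuousLinearEquiv.toContinuousLinearMap) := by
      refine ext_delta fun y => ?_
      change W (leftRegular Λ x (W.symm (W (delta y)))) =
        centralOp hu hi (F x) (leftRegular Γ (s x) (W (delta y)))
      rw [LinearIsometryEquiv.symm_apply_apply, leftRegular_delta]
      obtain ⟨c, hc1, hc2⟩ := hmul x y
      change hv.ell2Equiv hd _ = centralOp hu hi _ (leftRegular Γ _ (hv.ell2Equiv hd _))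
      rw [Orthonormal.ell2Equiv_delta, Orthonormal.ell2Equiv_delta]
      change cosetIsometry hu hi (s (x * y)) (CircleMaps.toL2 μ (F (x * y))) =
        centralOp hu hi _ (leftRegular Γ _ (cosetIsometry hu hi (s y) (CircleMaps.toL2 μ (F y))))
      rw [leftRegular_cosetIsometry hu hi hc, centralOp_cosetIsometry, hc1, cosetIsometry_mul,
        CircleMaps.mulL2_toL2, CircleMaps.mulL2_toL2, ← hc2, mul_comm]
    ext1 ξ
    have := DFunLike.congr_fun h1 (W.symm ξ)
    simpa using this
  have hR1 : R 1 = 1 := by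
    rw [← hconj, leftRegular_one, map_one]
  have hRj : ∀ d, R (j d) = centralOp hu hi (π d) := by
    intro d
    have : R (j d * 1) = centralOp hu hi (π d) * R 1 := by
      simp only [R]
      rw [hjF, hjs, centralOp_mul, mul_assoc]
    rwa [mul_one, hR1, mul_one] at this
  -- The commutants of all `R x` and of the left regular representation of `Γ` agree: either one
  -- commutes with all functions in `CircleMaps X`, the latter through the model `u` and the former
  -- through `π`. Modulo these functions, `R x` and `s x` act alike.
  refine ⟨W, fun S => ?_⟩
  simp only [hconj]
  constructor
  · intro hS x
    exact (commute_centralOp hu hi hu (fun c => by rw [centralOp_model]; exact hS _) _).mul_right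
      (hS _)
  · intro hS γ
    have hT : ∀ f, Commute S (centralOp hu hi f) :=
      commute_centralOp hu hi hπ fun d => by rw [← hRj]; exact hS _
    obtain ⟨x, c, rfl⟩ := hsurj γ
    have h2 : leftRegular Γ (s x) = centralOp hu hi (F x)⁻¹ * R x := by
      simp only [R]
      rw [← mul_assoc, ← centralOp_mul, inv_mul_cancel, centralOp_one, one_mul]
    rw [leftRegular_mul, ← centralOp_model hu hi, h2]
    exact (hT _).mul_right ((hT _).mul_right (hS x))

/-! ### The bimodule of a finite index subgroup -/

section Columns

variable {ι E K : Type*} [Fintype ι] [NormedAddCommGroup E] [InnerProductSpace ℂ E]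
  [CompleteSpace E] [NormedAddCommGroup K] [InnerProductSpace ℂ K] [CompleteSpace K]

/-- The isometry `ξ ↦ (J k)* ξ` given by operators `J k` with `∑ J k (J k)* = 1`. -/
noncomputable def columnIsometry (J : ι → E →L[ℂ] K)
    (hJ : ∑ k, J k ∘L ContinuousLinearMap.adjoint (J k) = 1) :
    K →ₗᵢ[ℂ] PiLp 2 (fun _ : ι => E) where
  toFun ξ := WithLp.toLp 2 fun k => ContinuousLinearMap.adjoint (J k) ξ
  map_add' ξ η := by ext k; simp
  map_smul' r ξ := by ext k; simp
  norm_map' ξ := by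
    have h : ⟪ξ, (∑ k, J k ∘L ContinuousLinearMap.adjoint (J k)) ξ⟫_ℂ = ⟪ξ, ξ⟫_ℂ := by
      rw [hJ, one_apply_eq_self]
    have h' : ∀ k, ⟪ξ, J k (ContinuousLinearMap.adjoint (J k) ξ)⟫_ℂ =
        ⟪ContinuousLinearMap.adjoint (J k) ξ, ContinuousLinearMap.adjoint (J k) ξ⟫_ℂ :=
      fun k => (ContinuousLinearMap.adjoint_inner_left _ _ _).symm
    simp only [sum_apply, inner_sum, ContinuousLinearMap.comp_apply, h'] at h
    rw [norm_eq_sqrt_re_inner (𝕜 := ℂ), norm_eq_sqrt_re_inner (𝕜 := ℂ) ξ, ← h, PiLp.inner_apply]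
    rfl

end Columns

section RightAction

variable (G : Type*) [Group G]

theorem modularConj_apply (ξ : Ell2 G) (g : G) : modularConj G ξ g = conj (ξ g⁻¹) := rfl

@[simp] theorem modularConj_modularConj (ξ : Ell2 G) : modularConj G (modularConj G ξ) = ξ := by
  refine lp.ext (funext fun g => ?_)
  rw [modularConj_apply, modularConj_apply, inv_inv, RCLike.conj_conj]

theorem inner_modularConj (ξ η : Ell2 G) :
    ⟪modularConj G ξ, modularConj G η⟫_ℂ = ⟪η, ξ⟫_ℂ := by
  rw [lp.inner_eq_tsum, lp.inner_eq_tsum, ← (Equiv.inv G).tsum_eq fun g => ⟪η g, ξ g⟫_ℂ]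
  refine tsum_congr fun g => ?_
  rw [modularConj_apply, modularConj_apply, RCLike.inner_apply, RCLike.inner_apply,
    RCLike.conj_conj, mul_comm]
  rfl

/-- The operator `J a J`. -/
noncomputable def modularConjugate (a : Ell2 G →L[ℂ] Ell2 G) : Ell2 G →L[ℂ] Ell2 G :=
  LinearMap.mkContinuous
    { toFun := fun ξ => modularConj G (a (modularConj G ξ))
      map_add' := fun ξ η => by simp
      map_smul' := fun r ξ => by
        rw [map_smulₛₗ, map_smul, map_smulₛₗ, RCLike.conj_conj, RingHom.id_apply] } ‖a‖ (fun ξ => by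
      change ‖modularConj G (a (modularConj G ξ))‖ ≤ _
      rw [LinearIsometryEquiv.norm_map]
      refine (a.le_opNorm _).trans ?_
      rw [LinearIsometryEquiv.norm_map])

theorem modularConjugate_apply (a : Ell2 G →L[ℂ] Ell2 G) (ξ : Ell2 G) :
    modularConjugate G a ξ = modularConj G (a (modularConj G ξ)) := rfl

theorem modularConjugate_mul (a b : Ell2 G →L[ℂ] Ell2 G) :
    modularConjugate G (a * b) = modularConjugate G a * modularConjugate G b := by
  ext1 ξ
  rw [mul_apply_eq_comp, modularConjugate_apply, modularConjugate_apply, modularConjugate_apply,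
    modularConj_modularConj, mul_apply_eq_comp]

theorem modularConjugate_modularConjugate (a : Ell2 G →L[ℂ] Ell2 G) :
    modularConjugate G (modularConjugate G a) = a := by
  ext1 ξ
  simp [modularConjugate_apply]

theorem modularConjugate_star (a : Ell2 G →L[ℂ] Ell2 G) :
    modularConjugate G (star a) = star (modularConjugate G a) := by
  rw [ContinuousLinearMap.star_eq_adjoint, ContinuousLinearMap.star_eq_adjoint,
    ContinuousLinearMap.eq_adjoint_iff]
  intro ξ η
  rw [modularConjugate_apply, modularConjugate_apply]
  conv_lhs => rw [← modularConj_modularConj G η]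
  conv_rhs => rw [← modularConj_modularConj G ξ]
  rw [inner_modularConj, inner_modularConj, ContinuousLinearMap.adjoint_inner_right]

/-- The representation of the opposite algebra of `L(G)` on `ℓ²(G)` by right multiplication. -/
noncomputable def rightRep : (LvN G)ᵐᵒᵖ →⋆ₐ[ℂ] (Ell2 G →L[ℂ] Ell2 G) where
  toFun b := modularConjugate G (star b.unop.1)
  map_one' := by
    ext1 ξ
    simp [modularConjugate_apply]
  map_mul' a b := by
    rw [← modularConjugate_mul, ← star_mul]
    rfl
  map_zero' := by
    ext1 ξ
    simp [modularConjugate_apply]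
  map_add' a b := by
    ext1 ξ
    simp [modularConjugate_apply]
  commutes' r := by
    ext1 ξ
    change modularConj G (star (algebraMap ℂ (Ell2 G →L[ℂ] Ell2 G) r) (modularConj G ξ)) = _
    rw [← algebraMap_star_comm, Algebra.algebraMap_eq_smul_one, Algebra.algebraMap_eq_smul_one]
    simp only [RCLike.star_def, smul_apply, one_apply_eq_self, map_smulₛₗ,
      RCLike.conj_conj, modularConj_modularConj]
  map_star' b := (modularConjugate_star G _).symm ▸ rfl

theorem rightRep_injective : Function.Injective (rightRep G) := by
  intro a b h
  have h1 : star a.unop.1 = star b.unop.1 := by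
    rw [← modularConjugate_modularConjugate G (star a.unop.1),
      ← modularConjugate_modularConjugate G (star b.unop.1)]
    exact congrArg _ h
  exact MulOpposite.unop_injective (Subtype.ext (star_injective h1))

/-- `J λ_g J` is a right translation, so it commutes with the left regular representation and with
all of `L(G)`. Conjugation by `J` exchanges the two roles. -/
theorem commute_rightRep_leftRegular (b : (LvN G)ᵐᵒᵖ) (g : G) :
    Commute (rightRep G b) (leftRegular G g) := by
  have h1 : ∀ h, Commute (modularConjugate G (leftRegular G g)) (leftRegular G h) := by
    intro h
    refine ContinuousLinearMap.ext fun ξ => lp.ext (funext fun k => ?_)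
    rw [mul_apply_eq_comp, mul_apply_eq_comp, modularConjugate_apply, leftRegular_apply,
      modularConjugate_apply]
    simp only [modularConj_apply, leftRegular_apply, mul_inv_rev, inv_inv, mul_assoc]
  have h2 : Commute (modularConjugate G (leftRegular G g)) (star b.unop.1) :=
    (mem_groupVN_iff.1 (star_mem b.unop.2)) _ h1
  have h3 := congrArg (modularConjugate G) h2.eq
  rw [modularConjugate_mul, modularConjugate_mul, modularConjugate_modularConjugate] at h3
  exact h3.symm

end RightAction

section Induction

variable {Γ : Type*} [Group Γ] (H : Subgroup Γ)

theorem orthonormal_delta_rightCoset (r : Γ) : Orthonormal ℂ fun h : H => delta ((h : Γ) * r) :=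
  (orthonormal_delta Γ).comp (fun h : H => (h : Γ) * r) fun _ _ hab =>
    Subtype.ext (mul_right_cancel hab)

/-- The isometry `ℓ²(H) → ℓ²(Γ)` onto the functions supported in the coset `H * r`. -/
noncomputable def cosetEmbedding (r : Γ) : Ell2 H →L[ℂ] Ell2 Γ :=
  (orthonormal_delta_rightCoset H r).ell2Isometry.toContinuousLinearMap

theorem cosetEmbedding_delta (r : Γ) (h : H) :
    cosetEmbedding H r (delta h) = delta ((h : Γ) * r) :=
  (orthonormal_delta_rightCoset H r).ell2Isometry_delta h

theorem cosetEmbedding_leftRegular (r : Γ) (h : H) :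
    cosetEmbedding H r ∘L leftRegular H h = leftRegular Γ h ∘L cosetEmbedding H r :=
  ext_delta fun k => by
    simp [cosetEmbedding_delta, mul_assoc]

theorem adjoint_cosetEmbedding_apply (r : Γ) (ξ : Ell2 Γ) (h : H) :
    ContinuousLinearMap.adjoint (cosetEmbedding H r) ξ h = ξ ((h : Γ) * r) := by
  rw [← inner_delta_left, ContinuousLinearMap.adjoint_inner_right, cosetEmbedding_delta,
    inner_delta_left]

theorem adjoint_cosetEmbedding_leftRegular (r : Γ) (h : H) :
    ContinuousLinearMap.adjoint (cosetEmbedding H r) ∘L leftRegular Γ h =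
      leftRegular H h ∘L ContinuousLinearMap.adjoint (cosetEmbedding H r) := by
  refine ContinuousLinearMap.ext fun ξ => lp.ext (funext fun k => ?_)
  rw [ContinuousLinearMap.comp_apply, ContinuousLinearMap.comp_apply,
    adjoint_cosetEmbedding_apply, leftRegular_apply, leftRegular_apply,
    adjoint_cosetEmbedding_apply, Subgroup.coe_mul, Subgroup.coe_inv, mul_assoc]

theorem adjoint_cosetEmbedding_self (r : Γ) :
    ContinuousLinearMap.adjoint (cosetEmbedding H r) ∘L cosetEmbedding H r = 1 := by
  classical
  refine ext_delta fun h => lp.ext (funext fun k => ?_)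
  rw [ContinuousLinearMap.comp_apply, adjoint_cosetEmbedding_apply, cosetEmbedding_delta,
    one_apply_eq_self, delta_apply, delta_apply]
  simp only [mul_left_inj, SetLike.coe_eq_coe]
  congr

theorem adjoint_cosetEmbedding_of_ne {r t : Γ} (hrt : r * t⁻¹ ∉ H) :
    ContinuousLinearMap.adjoint (cosetEmbedding H r) ∘L cosetEmbedding H t = 0 := by
  classical
  refine ext_delta fun h => lp.ext (funext fun k => ?_)
  rw [ContinuousLinearMap.comp_apply, adjoint_cosetEmbedding_apply, cosetEmbedding_delta,
    delta_apply, if_neg]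
  · rfl
  · intro heq
    apply hrt
    have : r * t⁻¹ = (k : Γ)⁻¹ * h := by
      rw [eq_inv_mul_iff_mul_eq, ← mul_assoc, heq, mul_inv_cancel_right]
    rw [this]
    exact H.mul_mem (H.inv_mem k.2) h.2

/-- Representatives of the right cosets. -/
noncomputable def cosetRep (q : Γ ⧸ H) : Γ := (Quotient.out q)⁻¹

theorem cosetRep_mul_inv_notMem {q q' : Γ ⧸ H} (h : q ≠ q') :
    cosetRep H q * (cosetRep H q')⁻¹ ∉ H := by
  intro hmem
  apply h
  rw [← QuotientGroup.out_eq' q, ← QuotientGroup.out_eq' q', QuotientGroup.eq]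
  simpa [cosetRep] using hmem

variable [Fintype (Γ ⧸ H)]

/-- The right cosets of `H` partition `Γ`, so `ℓ²(Γ)` is the orthogonal sum of the corresponding
copies of `ℓ²(H)`. -/
theorem sum_cosetEmbedding :
    ∑ q : Γ ⧸ H, cosetEmbedding H (cosetRep H q) ∘L
      ContinuousLinearMap.adjoint (cosetEmbedding H (cosetRep H q)) = 1 := by
  refine ext_delta fun γ => ?_
  obtain ⟨q, h, rfl⟩ : ∃ (q : Γ ⧸ H) (h : H), γ = h * cosetRep H q := by
    refine ⟨QuotientGroup.mk γ⁻¹, ⟨γ * (Quotient.out (QuotientGroup.mk γ⁻¹ : Γ ⧸ H)), ?_⟩, ?_⟩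
    · have h1 : (QuotientGroup.mk γ⁻¹ : Γ ⧸ H) =
          QuotientGroup.mk (Quotient.out (QuotientGroup.mk γ⁻¹ : Γ ⧸ H)) :=
        (QuotientGroup.out_eq' _).symm
      rw [QuotientGroup.eq, inv_inv] at h1
      exact h1
    · simp [cosetRep]
  rw [← cosetEmbedding_delta, sum_apply, Finset.sum_eq_single q]
  · have := DFunLike.congr_fun (adjoint_cosetEmbedding_self H (cosetRep H q)) (delta h)
    simp only [ContinuousLinearMap.comp_apply] at this ⊢
    rw [this]
    rfl
  · intro q' _ hne
    have := DFunLike.congr_fun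
      (adjoint_cosetEmbedding_of_ne H (cosetRep_mul_inv_notMem H hne)) (delta h)
    simp only [ContinuousLinearMap.comp_apply] at this ⊢
    rw [this]
    simp
  · simp

/-- The diagonal operator on `ℓ²(Γ)`, as the direct sum of copies of `ℓ²(H)`, given by an operator
on `ℓ²(H)`. -/
noncomputable def inducedOp (a : Ell2 H →L[ℂ] Ell2 H) : Ell2 Γ →L[ℂ] Ell2 Γ :=
  ∑ q : Γ ⧸ H, cosetEmbedding H (cosetRep H q) ∘L a ∘L
    ContinuousLinearMap.adjoint (cosetEmbedding H (cosetRep H q))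

theorem adjoint_cosetEmbedding_inducedOp (a : Ell2 H →L[ℂ] Ell2 H) (q : Γ ⧸ H) :
    ContinuousLinearMap.adjoint (cosetEmbedding H (cosetRep H q)) ∘L inducedOp H a =
      a ∘L ContinuousLinearMap.adjoint (cosetEmbedding H (cosetRep H q)) := by
  ext1 ξ
  rw [ContinuousLinearMap.comp_apply, inducedOp, sum_apply, map_sum,
    Finset.sum_eq_single q]
  · exact DFunLike.congr_fun (adjoint_cosetEmbedding_self H (cosetRep H q)) _
  · intro q' _ hne
    exact DFunLike.congr_fun
      (adjoint_cosetEmbedding_of_ne H (cosetRep_mul_inv_notMem H hne.symm)) _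
  · simp

theorem eq_of_adjoint_cosetEmbedding {S T : Ell2 Γ →L[ℂ] Ell2 Γ}
    (h : ∀ q : Γ ⧸ H, ContinuousLinearMap.adjoint (cosetEmbedding H (cosetRep H q)) ∘L S =
      ContinuousLinearMap.adjoint (cosetEmbedding H (cosetRep H q)) ∘L T) : S = T := by
  have h1 : ∀ S : Ell2 Γ →L[ℂ] Ell2 Γ, S = ∑ q : Γ ⧸ H, cosetEmbedding H (cosetRep H q) ∘L
      (ContinuousLinearMap.adjoint (cosetEmbedding H (cosetRep H q)) ∘L S) := by
    intro S
    conv_lhs => rw [← one_mul S, ← sum_cosetEmbedding H, Finset.sum_mul]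
    rfl
  rw [h1 S, h1 T]
  simp only [h]

theorem adjoint_inducedOp (a : Ell2 H →L[ℂ] Ell2 H) :
    star (inducedOp H a) = inducedOp H (star a) := by
  simp only [inducedOp, star_sum, ContinuousLinearMap.star_eq_adjoint,
    ContinuousLinearMap.adjoint_comp, ContinuousLinearMap.adjoint_adjoint]
  rfl

/-- If `T` commutes with the left translations by `Γ`, then each of its blocks between two coset
copies of `ℓ²(H)` commutes with those by `H`, hence with `a ∈ L(H)`. So `T` commutes with the
diagonal operator. -/
theorem inducedOp_mem {a : Ell2 H →L[ℂ] Ell2 H} (ha : a ∈ (groupVN H).toStarSubalgebra) :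
    inducedOp H a ∈ (groupVN Γ).toStarSubalgebra := by
  rw [mem_groupVN_iff]
  intro T hT
  refine eq_of_adjoint_cosetEmbedding H fun q => ?_
  have hcomm : ∀ q' : Γ ⧸ H, Commute
      (ContinuousLinearMap.adjoint (cosetEmbedding H (cosetRep H q)) ∘L T ∘L
        cosetEmbedding H (cosetRep H q')) a := by
    intro q'
    refine mem_groupVN_iff.1 ha _ fun h => ?_
    change (_ ∘L T ∘L _) ∘L leftRegular H h = leftRegular H h ∘L (_ ∘L T ∘L _)
    have h1 : T ∘L leftRegular Γ h = leftRegular Γ h ∘L T := hT h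
    rw [ContinuousLinearMap.comp_assoc, ContinuousLinearMap.comp_assoc,
      cosetEmbedding_leftRegular, ← ContinuousLinearMap.comp_assoc T, h1,
      ContinuousLinearMap.comp_assoc, ← ContinuousLinearMap.comp_assoc,
      adjoint_cosetEmbedding_leftRegular, ContinuousLinearMap.comp_assoc]
  have h2 : ContinuousLinearMap.adjoint (cosetEmbedding H (cosetRep H q)) ∘L
      (T ∘L inducedOp H a) = a ∘L ContinuousLinearMap.adjoint (cosetEmbedding H (cosetRep H q)) ∘L
        T ∘L (∑ q' : Γ ⧸ H, cosetEmbedding H (cosetRep H q') ∘L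
          ContinuousLinearMap.adjoint (cosetEmbedding H (cosetRep H q'))) := by
    ext1 ξ
    simp only [inducedOp, ContinuousLinearMap.comp_apply, sum_apply, map_sum]
    refine Finset.sum_congr rfl fun q' _ => ?_
    exact DFunLike.congr_fun (hcomm q').eq _
  change _ ∘L (T ∘L inducedOp H a) = _ ∘L (inducedOp H a ∘L T)
  rw [h2, sum_cosetEmbedding, ← ContinuousLinearMap.comp_assoc _ (inducedOp H a),
    adjoint_cosetEmbedding_inducedOp, ContinuousLinearMap.comp_assoc]
  rfl

/-- The representation of `L(H)` on `ℓ²(Γ)`. -/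
noncomputable def inducedRep : LvN H →⋆ₐ[ℂ] (Ell2 Γ →L[ℂ] Ell2 Γ) where
  toFun a := inducedOp H a.1
  map_one' := (sum_cosetEmbedding H)
  map_mul' a b := by
    refine eq_of_adjoint_cosetEmbedding H fun q => ?_
    change _ = _ ∘L (inducedOp H a.1 ∘L inducedOp H b.1)
    rw [← ContinuousLinearMap.comp_assoc, adjoint_cosetEmbedding_inducedOp,
      adjoint_cosetEmbedding_inducedOp, ContinuousLinearMap.comp_assoc,
      adjoint_cosetEmbedding_inducedOp]
    rfl
  map_zero' := by simp [inducedOp]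
  map_add' a b := by
    simp [inducedOp, Finset.sum_add_distrib]
  commutes' r := by
    ext1 ξ
    have h := DFunLike.congr_fun (sum_cosetEmbedding H) ξ
    rw [sum_apply, one_apply_eq_self] at h
    change inducedOp H (algebraMap ℂ (Ell2 H →L[ℂ] Ell2 H) r) ξ = algebraMap ℂ (Ell2 Γ →L[ℂ] Ell2 Γ) r ξ
    rw [Algebra.algebraMap_eq_smul_one, Algebra.algebraMap_eq_smul_one, inducedOp,
      sum_apply]
    conv_rhs => rw [smul_apply, one_apply_eq_self, ← h, Finset.smul_sum]
    refine Finset.sum_congr rfl fun q _ => ?_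
    simp
  map_star' a := (adjoint_inducedOp H a.1).symm

theorem inducedRep_injective : Function.Injective (inducedRep H) := by
  intro a b h
  have h1 := adjoint_cosetEmbedding_inducedOp H a.1 (QuotientGroup.mk 1)
  have h2 := adjoint_cosetEmbedding_inducedOp H b.1 (QuotientGroup.mk 1)
  have h3 : inducedOp H a.1 = inducedOp H b.1 := h
  rw [h3, h2] at h1
  have h4 := congrArg (fun T => T ∘L cosetEmbedding H (cosetRep H (QuotientGroup.mk 1))) h1
  simp only [ContinuousLinearMap.comp_assoc, adjoint_cosetEmbedding_self] at h4
  exact (Subtype.ext h4).symm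

end Induction

/-- An isomorphism, by means of a unitary, between `L(Λ)` and the von Neumann algebra of a finite
index subgroup of `Γ` gives a faithful bifinite bimodule. -/
theorem existsFaithfulBifiniteBimodule_of_intertwines {Λ Γ : Type u} [Group Λ] [Group Γ]
    (H : Subgroup Γ) (hH : H.FiniteIndex) {W : Ell2 Λ ≃ₗᵢ[ℂ] Ell2 H}
    (hW : IntertwinesGroupVN W) : ExistsFaithfulBifiniteBimodule Λ Γ := by
  classical
  have : Fintype (Γ ⧸ H) := Fintype.ofFinite _
  let e := Fintype.equivFin (Γ ⧸ H)
  let J : Fin (Fintype.card (Γ ⧸ H)) → Ell2 Λ →L[ℂ] Ell2 Γ := fun k =>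
    cosetEmbedding H (cosetRep H (e.symm k)) ∘L W.toContinuousLinearEquiv.toContinuousLinearMap
  have hadj : ∀ k ξ, ContinuousLinearMap.adjoint (J k) ξ =
      W.symm (ContinuousLinearMap.adjoint (cosetEmbedding H (cosetRep H (e.symm k))) ξ) := by
    intro k ξ
    refine ext_inner_left ℂ fun η => ?_
    rw [ContinuousLinearMap.adjoint_inner_right, ← LinearIsometryEquiv.inner_map_map W,
      LinearIsometryEquiv.apply_symm_apply, ContinuousLinearMap.adjoint_inner_right]
    rfl
  have hJ : ∑ k, J k ∘L ContinuousLinearMap.adjoint (J k) = 1 := by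
    rw [← sum_cosetEmbedding H, ← e.symm.sum_comp]
    refine Finset.sum_congr rfl fun k _ => ?_
    ext1 ξ
    rw [ContinuousLinearMap.comp_apply, hadj, ContinuousLinearMap.comp_apply]
    change cosetEmbedding H _ (W (W.symm _)) = _
    rw [LinearIsometryEquiv.apply_symm_apply]
    rfl
  have hid : ∑ k : Fin 1, (fun _ => (1 : Ell2 Γ →L[ℂ] Ell2 Γ)) k ∘L
      ContinuousLinearMap.adjoint ((fun _ => (1 : Ell2 Γ →L[ℂ] Ell2 Γ)) k) = 1 := by
    rw [Fin.sum_univ_one, ← ContinuousLinearMap.star_eq_adjoint, star_one]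
    rfl
  -- On the left, `ℓ²(Γ)` is a sum of as many copies of `ℓ²(Λ)` as the index of `H`, with columns `J
  -- k`. On the right it is a single copy of the standard module.
  let B : BifiniteBimodule Λ Γ (Ell2 Γ) :=
    { left := (inducedRep H).comp (StarAlgHomClass.toStarAlgHom hW.equiv)
      right := rightRep Γ
      left_right_comm := fun a b =>
        (mem_groupVN_iff.1 (inducedOp_mem H (hW.equiv a).2) _
          (commute_rightRep_leftRegular Γ b)).symm
      left_finite := ⟨_, columnIsometry J hJ, fun a ξ k => by
        change ContinuousLinearMap.adjoint (J k) (inducedOp H (hW.equiv a).1 ξ) =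
          a.1 (ContinuousLinearMap.adjoint (J k) ξ)
        have h := DFunLike.congr_fun
          (adjoint_cosetEmbedding_inducedOp H (hW.equiv a).1 (e.symm k)) ξ
        rw [ContinuousLinearMap.comp_apply, ContinuousLinearMap.comp_apply] at h
        rw [hadj, hadj, h]
        change W.symm (W (a.1 (W.symm _))) = _
        rw [LinearIsometryEquiv.symm_apply_apply]⟩
      right_finite := ⟨1, columnIsometry _ hid, fun b ξ k => by
        change ContinuousLinearMap.adjoint 1 (modularConjugate Γ (star b.1) ξ) =
          rightAct b (ContinuousLinearMap.adjoint 1 ξ)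
        rw [← ContinuousLinearMap.star_eq_adjoint, star_one]
        rfl⟩ }
  exact ⟨Ell2 Γ, inferInstance, inferInstance, inferInstance, B,
    (inducedRep_injective H).comp hW.equiv.injective, rightRep_injective Γ⟩

/-! ### Central extensions built from cocycles -/

section TwistedProduct

/-- The central extension of `G` by `D` given by a `2`-cocycle. -/
@[ext] structure TwistedProduct {G D : Type*} [Group G] [CommGroup D] (ω : Z2 G D) where
  fst : D
  snd : G

namespace TwistedProduct

variable {G D : Type*} [Group G] [CommGroup D] (ω : Z2 G D)

instance : Mul (TwistedProduct ω) := ⟨fun x y => ⟨x.1 * y.1 * ω.1 x.2 y.2, x.2 * y.2⟩⟩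

instance : One (TwistedProduct ω) := ⟨⟨1, 1⟩⟩

instance : Inv (TwistedProduct ω) := ⟨fun x => ⟨x.1⁻¹ * (ω.1 x.2⁻¹ x.2)⁻¹, x.2⁻¹⟩⟩

variable {ω}

@[simp] theorem mul_fst (x y : TwistedProduct ω) : (x * y).1 = x.1 * y.1 * ω.1 x.2 y.2 := rfl

@[simp] theorem mul_snd (x y : TwistedProduct ω) : (x * y).2 = x.2 * y.2 := rfl

@[simp] theorem one_fst : (1 : TwistedProduct ω).1 = 1 := rfl

@[simp] theorem one_snd : (1 : TwistedProduct ω).2 = 1 := rfl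

theorem inv_fst (x : TwistedProduct ω) : x⁻¹.1 = x.1⁻¹ * (ω.1 x.2⁻¹ x.2)⁻¹ := rfl

theorem inv_snd (x : TwistedProduct ω) : x⁻¹.2 = x.2⁻¹ := rfl

instance : Group (TwistedProduct ω) := Group.ofLeftAxioms
  (fun x y z => by
    ext
    · simp only [mul_fst, mul_snd]
      have h := ω.2.1 x.2 y.2 z.2
      calc x.1 * y.1 * ω.1 x.2 y.2 * z.1 * ω.1 (x.2 * y.2) z.2
          = x.1 * y.1 * z.1 * (ω.1 x.2 y.2 * ω.1 (x.2 * y.2) z.2) := by ac_rfl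
        _ = x.1 * (y.1 * z.1 * ω.1 y.2 z.2) * ω.1 x.2 (y.2 * z.2) := by rw [h]; ac_rfl
    · simp [mul_assoc])
  (fun x => by ext <;> simp [ω.2.2.2])
  (fun x => by
    ext
    · rw [mul_fst, inv_fst, inv_snd, one_fst, mul_right_comm x.1⁻¹, inv_mul_cancel, one_mul,
        inv_mul_cancel]
    · simp [inv_snd])

variable (ω)

/-- The extension `1 → D → TwistedProduct ω → G → 1`. -/
def extension : GroupExtension D (TwistedProduct ω) G where
  inl :=
    { toFun := fun d => ⟨d, 1⟩
      map_one' := rfl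
      map_mul' := fun a b => by ext <;> simp [ω.2.2.1] }
  rightHom :=
    { toFun := fun x => x.2
      map_one' := rfl
      map_mul' := fun _ _ => rfl }
  inl_injective := fun a b h => congrArg TwistedProduct.fst h
  range_inl_eq_ker_rightHom := by
    ext x
    constructor
    · rintro ⟨d, rfl⟩; rfl
    · intro h
      exact ⟨x.1, TwistedProduct.ext rfl (Eq.symm h)⟩
  rightHom_surjective := fun g => ⟨⟨1, g⟩, rfl⟩

theorem extension_inl (d : D) : (extension ω).inl d = ⟨d, 1⟩ := rfl

theorem inl_mul (d : D) (x : TwistedProduct ω) :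
    (extension ω).inl d * x = ⟨d * x.1, x.2⟩ := by
  ext <;> simp [extension_inl, ω.2.2.2]

theorem inl_comm (d : D) (x : TwistedProduct ω) :
    (extension ω).inl d * x = x * (extension ω).inl d := by
  rw [inl_mul]
  ext
  · simp [extension_inl, ω.2.2.1, mul_comm]
  · simp [extension_inl]

theorem isCentral_extension : (extension ω).IsCentral := by
  rintro _ ⟨d, rfl⟩
  exact Subgroup.mem_center_iff.2 fun x => (inl_comm ω d x).symm

theorem hasClass_extension : (extension ω).HasClass (QuotientGroup.mk ω) := by
  refine ⟨fun g => ⟨1, g⟩, ω, rfl, fun _ => rfl, fun g h => ?_, rfl⟩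
  rw [inl_mul]
  ext <;> simp

instance [Countable D] [Countable G] : Countable (TwistedProduct ω) :=
  Function.Injective.countable (f := fun x : TwistedProduct ω => (x.1, x.2))
    fun _ _ h => TwistedProduct.ext (congrArg Prod.fst h) (congrArg Prod.snd h)

end TwistedProduct

end TwistedProduct

/-! ### Extending characters and restricting extensions -/

section Extensions

variable {C Γ G : Type*} [CommGroup C] [Group Γ] [Group G] {E : GroupExtension C Γ G}

theorem GroupExtension.IsCentral.comm (hE : E.IsCentral) (c : C) (x : Γ) :
    E.inl c * x = x * E.inl c :=
  (Subgroup.mem_center_iff.1 (hE ⟨c, rfl⟩) x).symm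

theorem GroupExtension.exists_inl (E : GroupExtension C Γ G) {x : Γ} (hx : E.rightHom x = 1) :
    ∃ c, E.inl c = x := by
  have : x ∈ E.rightHom.ker := hx
  rwa [← E.range_inl_eq_ker_rightHom] at this

/-- A character `μ` of the kernel of a central extension extends to the whole group if and only if
`μ ∘ Ω = 1`. -/
theorem GroupExtension.HasClass.push_eq_one_iff (hE : E.IsCentral) {Ω : H2 G C}
    (hΩ : E.HasClass Ω) (μ : C →* Circle) :
    H2.push μ Ω = 1 ↔ ∃ χ : Γ →* Circle, χ.comp E.inl = μ := by
  obtain ⟨σ, ω, hσ1, hσ, hmul, rfl⟩ := hΩ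
  have hpush : H2.push μ (QuotientGroup.mk ω : H2 G C) = 1 ↔
      Z2.map (MonoidHom.id G) μ ω ∈ B2 G Circle := QuotientGroup.eq_one_iff _
  rw [hpush]
  constructor
  · rintro ⟨F, hF1, hF⟩
    -- The coordinate `κ x` of `x` along the kernel is multiplicative up to the cocycle. If `μ ∘ ω`
    -- is the coboundary of `F`, the factor `F (E.rightHom x)` corrects `μ (κ x)` to a character.
    have hdec : ∀ x : Γ, ∃ c, x = E.inl c * σ (E.rightHom x) := by
      intro x
      obtain ⟨c, hc⟩ := E.exists_inl (x := x * (σ (E.rightHom x))⁻¹) (by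
        rw [map_mul, map_inv, hσ, mul_inv_cancel])
      exact ⟨c, by rw [hc, inv_mul_cancel_right]⟩
    choose κ hκ using hdec
    have hκmul : ∀ x y, κ (x * y) = κ x * κ y * ω.1 (E.rightHom x) (E.rightHom y) := by
      intro x y
      apply E.inl_injective
      have h1 := hκ (x * y)
      rw [map_mul E.rightHom] at h1
      have h2 : x * y = E.inl (κ x) * E.inl (κ y) *
          E.inl (ω.1 (E.rightHom x) (E.rightHom y)) * σ (E.rightHom x * E.rightHom y) := by
        conv_lhs => rw [hκ x, hκ y]
        rw [mul_assoc (E.inl (κ x) * E.inl (κ y)), ← hmul, mul_assoc, ← mul_assoc (σ _),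
          ← hE.comm, mul_assoc, mul_assoc]
      rw [map_mul, map_mul]
      exact mul_right_cancel (h1.symm.trans h2)
    have hκinl : ∀ c, κ (E.inl c) = c := by
      intro c
      apply E.inl_injective
      have h1 := hκ (E.inl c)
      rw [E.rightHom_inl, hσ1, mul_one] at h1
      exact h1.symm
    refine ⟨⟨⟨fun x => μ (κ x) * F (E.rightHom x), ?_⟩, fun x y => ?_⟩, ?_⟩
    · have := hκinl 1
      rw [map_one] at this
      rw [this, map_one, map_one, hF1, one_mul]
    · have h3 : μ (ω.1 (E.rightHom x) (E.rightHom y)) = F (E.rightHom x) * F (E.rightHom y) *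
          (F (E.rightHom x * E.rightHom y))⁻¹ := hF _ _
      change μ (κ (x * y)) * F (E.rightHom (x * y)) =
        μ (κ x) * F (E.rightHom x) * (μ (κ y) * F (E.rightHom y))
      rw [hκmul, map_mul, map_mul, h3, map_mul E.rightHom, mul_assoc, inv_mul_cancel_right]
      exact mul_mul_mul_comm _ _ _ _
    · ext1 c
      change μ (κ (E.inl c)) * F (E.rightHom (E.inl c)) = μ c
      rw [hκinl, E.rightHom_inl, hF1, mul_one]
  · rintro ⟨χ, rfl⟩
    refine ⟨fun g => χ (σ g), by change χ (σ 1) = 1; rw [hσ1, map_one], fun g h => ?_⟩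
    change χ (E.inl (ω.1 g h)) = _
    rw [eq_mul_inv_iff_mul_eq, ← map_mul, ← map_mul, hmul]

/-- The restriction of a central extension of `G` to a subgroup of `G`. -/
def GroupExtension.restrict (E : GroupExtension C Γ G) (G₀ : Subgroup G) :
    GroupExtension C (G₀.comap E.rightHom) G₀ where
  inl := E.inl.codRestrict _ fun c => by
    rw [Subgroup.mem_comap, E.rightHom_inl]; exact G₀.one_mem
  rightHom := (E.rightHom.comp (Subgroup.subtype _)).codRestrict G₀ fun x => x.2
  inl_injective := fun a b h => E.inl_injective (congrArg Subtype.val h)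
  range_inl_eq_ker_rightHom := by
    ext x
    constructor
    · rintro ⟨c, rfl⟩
      exact Subtype.ext (E.rightHom_inl c)
    · intro h
      obtain ⟨c, hc⟩ := E.exists_inl (congrArg Subtype.val h)
      exact ⟨c, Subtype.ext hc⟩
  rightHom_surjective := fun g => by
    obtain ⟨x, hx⟩ := E.rightHom_surjective g.1
    exact ⟨⟨x, by rw [Subgroup.mem_comap, hx]; exact g.2⟩, Subtype.ext hx⟩

theorem GroupExtension.IsCentral.restrict (hE : E.IsCentral) (G₀ : Subgroup G) :
    (E.restrict G₀).IsCentral := by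
  rintro _ ⟨c, rfl⟩
  exact Subgroup.mem_center_iff.2 fun x => Subtype.ext (hE.comm c x.1).symm

theorem GroupExtension.HasClass.restrict {Ω : H2 G C} (hΩ : E.HasClass Ω) (G₀ : Subgroup G) :
    (E.restrict G₀).HasClass (Ω.restrict G₀) := by
  obtain ⟨σ, ω, hσ1, hσ, hmul, rfl⟩ := hΩ
  refine ⟨fun g => ⟨σ g, by rw [Subgroup.mem_comap, hσ]; exact g.2⟩,
    Z2.map G₀.subtype (MonoidHom.id C) ω, Subtype.ext hσ1, fun g => Subtype.ext (hσ g),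
    fun g h => Subtype.ext (hmul g h), rfl⟩

end Extensions

/-! ### Finite conjugacy classes and torsion -/

section FiniteConjugacy

theorem conjugatesOf_map_of_surjective {G H : Type*} [Group G] [Group H] (f : G →* H)
    (hf : Function.Surjective f) (x : G) (hx : (conjugatesOf x).Finite) :
    (conjugatesOf (f x)).Finite := by
  refine (hx.image f).subset ?_
  intro y hy
  obtain ⟨k, rfl⟩ := isConj_iff.1 hy
  obtain ⟨g, rfl⟩ := hf k
  exact ⟨g * x * g⁻¹, isConj_iff.2 ⟨g, rfl⟩, by simp⟩

/-- An element of a finite index subgroup with finitely many conjugates there has finitely many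
conjugates in the whole group. -/
theorem finite_conjugatesOf_coe {G : Type*} [Group G] (H : Subgroup G) [H.FiniteIndex] (x : H)
    (hx : (conjugatesOf x).Finite) : (conjugatesOf (x : G)).Finite := by
  refine (Set.finite_iUnion fun q : G ⧸ H =>
    hx.image fun y : H => q.out * (y : G) * q.out⁻¹).subset ?_
  intro y hy
  obtain ⟨g, rfl⟩ := isConj_iff.1 hy
  have hg : (QuotientGroup.mk g : G ⧸ H).out⁻¹ * g ∈ H := by
    rw [← QuotientGroup.eq]
    exact QuotientGroup.out_eq' _
  refine Set.mem_iUnion.2 ⟨QuotientGroup.mk g, _,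
    isConj_iff.2 ⟨(⟨_, hg⟩ : H), rfl⟩, ?_⟩
  simp only [Subgroup.coe_mul, Subgroup.coe_inv]
  group

theorem IsICC.of_finiteIndex {G : Type*} [Group G] (hG : IsICC G) (H : Subgroup G)
    [H.FiniteIndex] : IsICC H := by
  intro x hx hfin
  exact hG x (fun h => hx (Subtype.ext h)) (finite_conjugatesOf_coe H x hfin)

variable {C Γ G : Type*} [CommGroup C] [Group Γ] [Group G]

/-- In a central extension of an icc group, an element with finitely many conjugates lies in the
kernel. -/
theorem IsICC.exists_inl_of_finite_conjugatesOf (hG : IsICC G) (E : GroupExtension C Γ G) {x : Γ}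
    (hx : (conjugatesOf x).Finite) : ∃ c, E.inl c = x :=
  E.exists_inl (by_contra fun h =>
    hG _ h (conjugatesOf_map_of_surjective E.rightHom E.rightHom_surjective x hx))

theorem finite_conjugatesOf_of_mem_center {x : Γ} (hx : ∀ y, x * y = y * x) :
    (conjugatesOf x).Finite := by
  refine (Set.finite_singleton x).subset ?_
  intro y hy
  obtain ⟨g, rfl⟩ := isConj_iff.1 hy
  rw [Set.mem_singleton_iff, ← hx, mul_inv_cancel_right]

/-- A central extension of an icc group by a torsion free group has no central torsion. -/
theorem eq_one_of_central_of_isOfFinOrder (hG : IsICC G) (hC : IsMulTorsionFree C)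
    (E : GroupExtension C Γ G) {x : Γ} (hx : ∀ y, x * y = y * x) (hfin : IsOfFinOrder x) :
    x = 1 := by
  obtain ⟨c, rfl⟩ := hG.exists_inl_of_finite_conjugatesOf E (finite_conjugatesOf_of_mem_center hx)
  rw [E.inl_injective.isOfFinOrder_iff] at hfin
  by_contra hne
  exact isMulTorsionFree_iff_not_isOfFinOrder.1 hC (fun h => hne (by rw [h, map_one])) hfin

/-- The elements of finite order with finitely many conjugates. -/
def fcTorsion (Γ : Type*) [Group Γ] : Set Γ := {x | (conjugatesOf x).Finite ∧ IsOfFinOrder x}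

/-- An element with finite conjugacy class lies in the kernel because `G` is icc, so only the
torsion of `C` contributes. -/
theorem finite_fcTorsion (hG : IsICC G) (E : GroupExtension C Γ G)
    (hC : {c : C | IsOfFinOrder c}.Finite) : (fcTorsion Γ).Finite := by
  refine (hC.image E.inl).subset ?_
  rintro x ⟨hx, hfin⟩
  obtain ⟨c, rfl⟩ := hG.exists_inl_of_finite_conjugatesOf E hx
  exact ⟨c, (E.inl_injective.isOfFinOrder_iff).1 hfin, rfl⟩

/-- If a group with an infinite central torsion subgroup is virtually isomorphic to `Γ`, then `Γ`
has infinitely many elements of finite order with finitely many conjugates. -/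
theorem infinite_fcTorsion_of_virtuallyIsomorphic {V Λ : Type*} [CommGroup V] [Group Λ]
    [Infinite V] (hV : ∀ v : V, IsOfFinOrder v) (j : V →* Λ) (hj : Function.Injective j)
    (hc : ∀ v x, j v * x = x * j v) (h : VirtuallyIsomorphic Λ Γ) : (fcTorsion Γ).Infinite := by
  obtain ⟨Λ₁, Γ₁, N, S, _, _, hΛ, hΓ, hN, hS, ⟨e⟩⟩ := h
  let V₁ : Subgroup V := Λ₁.comap j
  have hV₁ : V₁.FiniteIndex := ⟨by
    rw [Subgroup.index_comap]
    have : Λ₁.IsFiniteRelIndex j.range := Subgroup.isFiniteRelIndex_of_finiteIndex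
    exact Subgroup.relIndex_ne_zero⟩
  have hV₁inf : Infinite V₁ := by
    by_contra hcon
    rw [not_infinite_iff_finite] at hcon
    have : Finite V := Finite.of_equiv _ (Subgroup.groupEquivQuotientProdSubgroup (s := V₁)).symm
    exact not_finite V
  let f : V₁ →* Λ₁ ⧸ N :=
    (QuotientGroup.mk' N).comp ((j.comp V₁.subtype).codRestrict Λ₁ fun v => v.2)
  -- The fibres of `f` embed in the finite group `N`, while `V₁` is infinite.
  have hR : (Set.range f).Infinite := by
    intro hfin
    refine Set.infinite_univ (α := V₁) (Set.Finite.of_finite_fibers f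
      (by rwa [Set.image_univ]) fun y _ => ?_)
    rcases (Set.univ ∩ f ⁻¹' {y}).eq_empty_or_nonempty with h0 | ⟨v₀, -, hv₀⟩
    · rw [h0]; exact Set.finite_empty
    have hmem : ∀ v ∈ Set.univ ∩ f ⁻¹' {y},
        (j.comp V₁.subtype).codRestrict Λ₁ (fun v => v.2) (v₀⁻¹ * v) ∈ N := by
      rintro v ⟨-, hv⟩
      have : f (v₀⁻¹ * v) = 1 := by
        rw [map_mul, map_inv, Set.mem_singleton_iff.1 hv₀, Set.mem_singleton_iff.1 hv,
          inv_mul_cancel]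
      exact (QuotientGroup.eq_one_iff _).1 this
    refine Finite.of_injective (fun v : ↥(Set.univ ∩ f ⁻¹' {y}) => (⟨_, hmem v v.2⟩ : N)) ?_
    intro v w hvw
    have h1 : j ((v₀⁻¹ * v.1 : V₁) : V) = j ((v₀⁻¹ * w.1 : V₁) : V) :=
      congrArg (fun n : N => ((n : Λ₁) : Λ)) hvw
    exact Subtype.ext (mul_left_cancel (Subtype.ext (hj h1)))
  have hR' : ((fun y => ((Quotient.out (e y) : Γ₁) : Γ)) '' Set.range f).Infinite := by
    refine hR.image fun a _ b _ hab => e.injective ?_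
    have := Subtype.ext hab
    rw [← QuotientGroup.out_eq' (e a), ← QuotientGroup.out_eq' (e b)]
    exact congrArg _ this
  refine hR'.mono ?_
  rintro _ ⟨_, ⟨v, rfl⟩, rfl⟩
  set y : Γ₁ := Quotient.out (e (f v)) with hy
  have hmk : (QuotientGroup.mk y : Γ₁ ⧸ S) = e (f v) := QuotientGroup.out_eq' _
  -- The image of `v` is central and torsion in the quotient by `S`. As `S` is finite, its lift `y`
  -- has finitely many conjugates in `Γ₁`, all in `y * S`, and a power of `y` lies in `S`, so `y`
  -- has finite order.
  have hcent : ∀ z, e (f v) * z = z * e (f v) := by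
    intro z
    obtain ⟨w, rfl⟩ := e.surjective z
    obtain ⟨w, rfl⟩ := QuotientGroup.mk_surjective w
    rw [← map_mul, ← map_mul]
    congr 1
    change (QuotientGroup.mk _ : Λ₁ ⧸ N) * QuotientGroup.mk w = QuotientGroup.mk w * QuotientGroup.mk _
    rw [← QuotientGroup.mk_mul, ← QuotientGroup.mk_mul]
    congr 1
    exact Subtype.ext (hc _ _)
  constructor
  · refine finite_conjugatesOf_coe Γ₁ y ?_
    have hsub : conjugatesOf y ⊆ (fun s : S => y * s) '' Set.univ := by
      intro z hz
      obtain ⟨g, rfl⟩ := isConj_iff.1 hz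
      have h1 : y⁻¹ * (g * y * g⁻¹) ∈ S := by
        rw [← QuotientGroup.eq_one_iff]
        rw [QuotientGroup.mk_mul, QuotientGroup.mk_mul, QuotientGroup.mk_mul, QuotientGroup.mk_inv,
          QuotientGroup.mk_inv, hmk, ← hcent, mul_inv_cancel_right, inv_mul_cancel]
      exact ⟨⟨_, h1⟩, trivial, by simp⟩
    exact (Set.finite_univ.image _).subset hsub
  · obtain ⟨n, hn, hvn⟩ := isOfFinOrder_iff_pow_eq_one.1 (hV v.1)
    have h1 : y ^ n ∈ S := by
      rw [← QuotientGroup.eq_one_iff, QuotientGroup.mk_pow, hmk, ← map_pow, ← map_pow]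
      have : v ^ n = 1 := Subtype.ext hvn
      rw [this, map_one, map_one]
    obtain ⟨m, hm, hym⟩ := isOfFinOrder_iff_pow_eq_one.1 (isOfFinOrder_of_finite (⟨_, h1⟩ : S))
    refine isOfFinOrder_iff_pow_eq_one.2 ⟨n * m, Nat.mul_pos hn hm, ?_⟩
    have := congrArg (fun s : S => ((s : Γ₁) : Γ)) hym
    rw [pow_mul]
    simpa using this

end FiniteConjugacy

instance countable_quotientGroup {A : Type*} [Group A] [Countable A] (H : Subgroup A) :
    Countable (A ⧸ H) := Quotient.countable

/-! ### Cohomologous cocycles give isomorphic algebras -/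

section Twisting

variable {C D Γ G : Type*} [CommGroup C] [CommGroup D] [Group Γ] [Group G]

/-- If the images in the circle-valued functions of the classes of two central extensions of `G`
differ by a coboundary, the group von Neumann algebras of the extensions are isomorphic. -/
theorem exists_intertwinesGroupVN_twistedProduct {X : Type*} [MeasurableSpace X] {μ : Measure X}
    [IsProbabilityMeasure μ] {u : C →* CircleMaps X} (hu : IsFourierModel μ u)
    {π : D →* CircleMaps X} (hπ : IsFourierModel μ π) {E : GroupExtension C Γ G}
    (hE : E.IsCentral) {σ : G → Γ} {ω : Z2 G C} (hσ : ∀ g, E.rightHom (σ g) = g)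
    (hσmul : ∀ g h, σ g * σ h = E.inl (ω.1 g h) * σ (g * h)) (ω' : Z2 G D)
    (f : G → CircleMaps X)
    (hf : ∀ g h, f g * f h * u (ω.1 g h) = f (g * h) * π (ω'.1 g h)) :
    ∃ W : Ell2 (TwistedProduct ω') ≃ₗᵢ[ℂ] Ell2 Γ, IntertwinesGroupVN W := by
  refine exists_intertwinesGroupVN hu hπ E.inl_injective hE.comm (TwistedProduct.extension ω').inl
    (fun x => π x.1 * f x.2) (fun x => σ x.2) (fun x y => ⟨ω.1 x.2 y.2, hσmul _ _, ?_⟩)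
    (fun d x => ?_) (fun d x => ?_) (map_one _) (fun x y c h => ⟨x.1 * y.1⁻¹, ?_⟩) (fun γ => ?_)
  · rw [TwistedProduct.mul_fst, TwistedProduct.mul_snd, map_mul, map_mul]
    calc π x.1 * f x.2 * (π y.1 * f y.2) * u (ω.1 x.2 y.2)
        = π x.1 * π y.1 * (f x.2 * f y.2 * u (ω.1 x.2 y.2)) := by ac_rfl
      _ = π x.1 * π y.1 * π (ω'.1 x.2 y.2) * f (x.2 * y.2) := by rw [hf]; ac_rfl
  · rw [TwistedProduct.inl_mul]
    simp only [map_mul, mul_assoc]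
  · rw [TwistedProduct.inl_mul]
  · have h1 := congrArg E.rightHom h
    rw [map_mul, E.rightHom_inl, one_mul, hσ, hσ] at h1
    rw [TwistedProduct.inl_mul]
    exact TwistedProduct.ext (by simp) h1
  · obtain ⟨c, hc⟩ := E.exists_inl (x := γ * (σ (E.rightHom γ))⁻¹) (by
      rw [map_mul, map_inv, hσ, mul_inv_cancel])
    exact ⟨⟨1, E.rightHom γ⟩, c, by rw [hc, inv_mul_cancel_right]⟩

theorem MatchesAlong.symm {Ω : H2 G C} {Ω' : H2 G D} {C₀ : Subgroup C} {D₀ : Subgroup D}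
    {ζ : C₀ ≃* D₀} (h : MatchesAlong Ω Ω' ζ) : MatchesAlong Ω' Ω ζ.symm := fun ν μ hμν =>
  (h μ ν fun c => by rw [← hμν, MulEquiv.symm_apply_apply]).symm

theorem eIndex_eq_top {C₀ : Subgroup C} (h : Infinite (C ⧸ C₀)) : eIndex C₀ = ⊤ := by
  rw [eIndex, ENat.card_eq_top.2 h, ENat.toENNReal_top]

end Twisting

/-! ### Infinite kernel: enlarging the center -/

section InfiniteKernel

variable {C Γ G : Type*} [CommGroup C] [Group Γ] [Group G]

/-- The kernel of the map from `C` to the abelianization of an extension by `C`. -/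
def GroupExtension.abelianizationKer (E : GroupExtension C Γ G) : Subgroup C :=
  (Abelianization.of.comp E.inl).ker

/-- `C ⧸ E.abelianizationKer` embeds in the abelianization of `Γ`, and homomorphisms into divisible
groups extend along this embedding. -/
theorem GroupExtension.exists_extension_of_rootable {A : Type*} [CommGroup A]
    (hA : ∀ n : ℕ, n ≠ 0 → ∀ d : A, ∃ e : A, e ^ n = d) (E : GroupExtension C Γ G)
    (b : C ⧸ E.abelianizationKer →* A) :
    ∃ β : Γ →* A, ∀ c, β (E.inl c) = b (QuotientGroup.mk c) := by
  obtain ⟨B, hB⟩ := MonoidHom.exists_extension_of_rootable hA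
    (QuotientGroup.kerLift (Abelianization.of.comp E.inl)) (QuotientGroup.kerLift_injective _) b
  exact ⟨B.comp Abelianization.of, fun c => DFunLike.congr_fun hB (QuotientGroup.mk c)⟩

/-- Characters in the kernel of `Θ(Ω)` extend to `Γ`, hence factor through this quotient. A finite
quotient would have only finitely many characters. -/
theorem GroupExtension.infinite_quotient_abelianizationKer {E : GroupExtension C Γ G}
    (hE : E.IsCentral) {Ω : H2 G C} (hΩ : E.HasClass Ω) (h : Infinite (Theta Ω).ker) :
    Infinite (C ⧸ E.abelianizationKer) := by
  by_contra hfin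
  rw [not_infinite_iff_finite] at hfin
  have hker : ∀ μ : (Theta Ω).ker, E.abelianizationKer ≤ μ.1.ker := by
    rintro ⟨μ, hμ⟩ c hc
    obtain ⟨χ, rfl⟩ := (hΩ.push_eq_one_iff hE μ).1 hμ
    have h1 : Abelianization.lift χ (Abelianization.of (E.inl c)) = χ (E.inl c) :=
      Abelianization.lift_apply_of _ _
    have h2 : Abelianization.of (E.inl c) = 1 := hc
    rw [h2, map_one] at h1
    exact h1.symm
  have hinj : Function.Injective fun μ : (Theta Ω).ker =>
      Circle.toUnits.comp (QuotientGroup.lift E.abelianizationKer μ.1 (hker μ)) := by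
    intro μ ν hμν
    ext1
    ext1 c
    have h1 := congrArg Units.val (DFunLike.congr_fun hμν (QuotientGroup.mk c))
    exact Circle.ext h1
  have : Finite (C ⧸ E.abelianizationKer →* ℂˣ) := inferInstance
  exact not_finite_iff_infinite.2 h (Finite.of_injective _ hinj)

instance isProbabilityMeasure_restrict_Ioc_zero_one :
    IsProbabilityMeasure ((volume : Measure ℝ).restrict (Set.Ioc 0 1)) := ⟨by simp⟩

/-- If `Θ(Ω)` has infinite kernel, then, up to isomorphism of the group von Neumann algebra, the
center of the extension may be enlarged by any countable abelian group `V`. -/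
theorem GroupExtension.exists_cocycle_prod [Countable C] (V : Type*) [CommGroup V] [Countable V]
    {E : GroupExtension C Γ G} (hE : E.IsCentral) {Ω : H2 G C} (hΩ : E.HasClass Ω)
    (h : Infinite (Theta Ω).ker) :
    ∃ ω' : Z2 G (C × V),
      (∃ W : Ell2 (TwistedProduct ω') ≃ₗᵢ[ℂ] Ell2 Γ, IntertwinesGroupVN W) ∧
      ∃ (C₀ : Subgroup C) (D₀ : Subgroup (C × V)) (ζ : C₀ ≃* D₀), eIndex C₀ = ⊤ ∧ eIndex D₀ = ⊤ ∧
        MatchesAlong Ω (QuotientGroup.mk ω' : H2 G (C × V)) ζ := by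
  have hQ : Infinite (C ⧸ E.abelianizationKer) :=
    GroupExtension.infinite_quotient_abelianizationKer hE hΩ h
  have hclass := hΩ
  obtain ⟨σ, ω, -, hσ, hσmul, rfl⟩ := hclass
  set C₀ := E.abelianizationKer
  refine ⟨Z2.map (MonoidHom.id G) (MonoidHom.inl C V) ω, ?_, ?_⟩
  -- The models of `C` and of `C × V` share the factor `s`, which extends the canonical model of
  -- `C₀`. They differ only in `v` and `w`, which live on the same interval since both quotients are
  -- infinite.
  · obtain ⟨s, hs⟩ := MonoidHom.exists_extension_of_rootable CircleMaps.exists_pow_eq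
      C₀.subtype C₀.subtype_injective (dualEval C₀)
    obtain ⟨v, hv⟩ := exists_isFourierModel_uniform (C ⧸ C₀)
    obtain ⟨w, hw⟩ := exists_isFourierModel_uniform ((C ⧸ C₀) × V)
    have hu := isFourierModel_productModel (s := s) (v := v) (q := QuotientGroup.mk' C₀)
      (μ := dualHaar C₀) C₀.subtype (QuotientGroup.mk'_surjective C₀)
      (fun m => (QuotientGroup.eq_one_iff _).2 m.2)
      (fun d hd => ⟨⟨d, (QuotientGroup.eq_one_iff _).1 hd⟩, rfl⟩) hv
      (by rw [hs]; exact isFourierModel_dualEval C₀)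
    have hπ := isFourierModel_productModel (s := s.comp (MonoidHom.fst C V)) (v := w)
      (q := (QuotientGroup.mk' C₀).prodMap (MonoidHom.id V))
      (μ := dualHaar C₀) ((MonoidHom.inl C V).comp C₀.subtype)
      (Function.Surjective.prodMap (QuotientGroup.mk'_surjective C₀) Function.surjective_id)
      (fun m => Prod.ext ((QuotientGroup.eq_one_iff _).2 m.2) rfl)
      (fun d hd => ⟨⟨d.1, (QuotientGroup.eq_one_iff _).1 (congrArg Prod.fst hd)⟩,
        Prod.ext rfl (congrArg Prod.snd hd).symm⟩) hw
      (by
        rw [← MonoidHom.comp_assoc, MonoidHom.comp_assoc _ _ s, MonoidHom.fst_comp_inl,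
          MonoidHom.comp_id, hs]
        exact isFourierModel_dualEval C₀)
    -- The two models of `C` differ by `w / v`, which is trivial on `C₀` and therefore extends to a
    -- homomorphism `β` on `Γ`. Along the section, `β` is the coboundary between the two cocycles.
    obtain ⟨β, hβ⟩ := E.exists_extension_of_rootable CircleMaps.exists_pow_eq
      ((CircleMaps.comp (Prod.snd : dualSubgroup C₀ × ℝ → ℝ) measurable_snd).comp
        (w.comp (MonoidHom.inl (C ⧸ C₀) V) / v))
    refine exists_intertwinesGroupVN_twistedProduct hu hπ hE hσ hσmul _ (fun g => β (σ g))
      fun g k => ?_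
    have key : ∀ c, β (E.inl c) * productModel s v (QuotientGroup.mk' C₀) c =
        productModel (s.comp (MonoidHom.fst C V)) w
          ((QuotientGroup.mk' C₀).prodMap (MonoidHom.id V)) (c, 1) := by
      intro c
      rw [hβ]
      apply Subtype.ext
      funext z
      change (w (QuotientGroup.mk c, 1)).1 z.2 / (v (QuotientGroup.mk c)).1 z.2 *
        ((s c).1 z.1 * (v (QuotientGroup.mk c)).1 z.2) =
        (s c).1 z.1 * (w (QuotientGroup.mk c, 1)).1 z.2
      rw [mul_comm ((s c).1 z.1), ← mul_assoc, div_mul_cancel, mul_comm]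
    rw [← map_mul, hσmul, map_mul, mul_comm (β _), mul_assoc, key]
    rfl
  · have hn : Function.Injective ((MonoidHom.inl C V).comp C₀.subtype) :=
      fun a b hab => Subtype.ext (congrArg Prod.fst hab)
    refine ⟨C₀, _, MonoidHom.ofInjective hn, eIndex_eq_top hQ, eIndex_eq_top ?_, fun μ ν hμν => ?_⟩
    · have hle : ((MonoidHom.inl C V).comp C₀.subtype).range ≤ C₀.comap (MonoidHom.fst C V) := by
        rintro _ ⟨c, rfl⟩
        exact c.2
      refine Infinite.of_surjective (QuotientGroup.map _ C₀ (MonoidHom.fst C V) hle) fun q => ?_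
      obtain ⟨c, rfl⟩ := QuotientGroup.mk_surjective q
      exact ⟨QuotientGroup.mk (c, 1), rfl⟩
    -- Two characters of `C` that agree on `C₀` differ by one that extends to `Γ`, that is, by an
    -- element of the kernel of `Θ(Ω)`.
    · have hker : C₀ ≤ (ν.comp (MonoidHom.inl C V) / μ).ker := by
        intro c hc
        exact div_eq_one.2 (hμν ⟨c, hc⟩)
      obtain ⟨χ, hχ⟩ := E.exists_extension_of_rootable Circle.exists_pow_eq
        (QuotientGroup.lift C₀ _ hker)
      have h1 : Theta (QuotientGroup.mk ω : H2 G C) (ν.comp (MonoidHom.inl C V) / μ) = 1 :=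
        (hΩ.push_eq_one_iff hE _).2 ⟨χ, MonoidHom.ext hχ⟩
      rw [map_div, div_eq_one] at h1
      exact h1.symm

end InfiniteKernel

/-! ### A kernel element of prime order: splitting off a cyclic group -/

section PrimeOrder

variable {C Γ G : Type*} [CommGroup C] [Group Γ] [Group G]

/-- An element of prime order in the kernel of `Θ(Ω)` splits a cyclic group off the kernel of the
extension, up to isomorphism of the group von Neumann algebra. -/
theorem GroupExtension.exists_cocycle_of_orderOf_prime [Countable C] {E : GroupExtension C Γ G}
    (hE : E.IsCentral) {Ω : H2 G C} (hΩ : E.HasClass Ω) {μ : C →* Circle} (hμ : Theta Ω μ = 1)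
    {p : ℕ} (hp : p.Prime) (hμp : orderOf μ = p) :
    ∃ ω' : Z2 G (μ.ker × (C ⧸ μ.ker)),
      (∃ W : Ell2 (TwistedProduct ω') ≃ₗᵢ[ℂ] Ell2 Γ, IntertwinesGroupVN W) ∧
      CocycleSimT 1 Ω (QuotientGroup.mk ω' : H2 G (μ.ker × (C ⧸ μ.ker))) ∧
      ∃ d : μ.ker × (C ⧸ μ.ker), d ≠ 1 ∧ IsOfFinOrder d := by
  have hp0 : (p : ℝ) ≠ 0 := by exact_mod_cast hp.ne_zero
  have hpi : (2 * Real.pi : ℝ) ≠ 0 := by positivity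
  have hμpow : ∀ c, μ c ^ p = 1 := fun c => by
    have := DFunLike.congr_fun (pow_orderOf_eq_one μ) c
    rwa [hμp] at this
  obtain ⟨χ, hχ⟩ := (hΩ.push_eq_one_iff hE μ).1 hμ
  obtain ⟨σ, ω, hσ1, hσ, hσmul, rfl⟩ := hΩ
  obtain ⟨c₀, hc₀⟩ : ∃ c₀, μ c₀ = Circle.exp (2 * Real.pi / p) := by
    obtain ⟨c, hc⟩ : ∃ c, μ c ≠ 1 := by
      by_contra hcon
      push Not at hcon
      have h1 : μ = 1 := MonoidHom.ext hcon
      rw [h1, orderOf_one] at hμp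
      exact hp.one_lt.ne hμp
    have : Fact p.Prime := ⟨hp⟩
    have : NeZero p := ⟨hp.ne_zero⟩
    have hord : orderOf (μ c) = p := orderOf_eq_prime (hμpow c) hc
    have hprim : IsPrimitiveRoot (Circle.coeHom (μ c)) p :=
      (hord ▸ IsPrimitiveRoot.orderOf (μ c)).map_of_injective Circle.coe_injective
    obtain ⟨i, -, hi⟩ := hprim.eq_pow_of_pow_eq_one (ξ := (Circle.exp (2 * Real.pi / p) : ℂ)) (by
      rw [← Circle.coe_pow, ← Circle.exp_natCast_mul, mul_div_cancel₀ _ hp0, Circle.exp_two_pi,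
        Circle.coe_one])
    exact ⟨c ^ i, Circle.ext (by rw [map_pow, Circle.coe_pow]; exact hi)⟩
  -- The coboundary of the angle `t` lifts `μ ∘ ω` to the reals. Since `μ ^ p = 1`, it takes values
  -- in `(2π / p) ℤ`, which gives the integer cocycle `k`.
  let t : G → ℝ := fun g => Complex.arg (χ (σ g))
  have ht : ∀ g, Circle.exp (t g) = χ (σ g) := fun g => Circle.exp_arg _
  have ht1 : t 1 = 0 := by simp [t, hσ1]
  have hτ : ∀ g h, Circle.exp (t g + t h - t (g * h)) = μ (ω.1 g h) := by
    intro g h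
    rw [Circle.exp_sub, Circle.exp_add, ht, ht, ht, ← map_mul, hσmul, map_mul, mul_div_cancel_right,
      ← hχ]
    rfl
  have hk : ∀ g h, ∃ k : ℤ, (p / (2 * Real.pi)) * (t g + t h - t (g * h)) = k := by
    intro g h
    have h1 : Circle.exp (p * (t g + t h - t (g * h))) = Circle.exp 0 := by
      rw [Circle.exp_natCast_mul, hτ, hμpow, Circle.exp_zero]
    obtain ⟨k, hk⟩ := Circle.exp_eq_exp.1 h1
    refine ⟨k, ?_⟩
    rw [zero_add] at hk
    rw [div_mul_eq_mul_div, hk, mul_div_assoc, div_self hpi, mul_one]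
  choose k hk using hk
  have hkcocycle : ∀ g h l, k g h + k (g * h) l = k g (h * l) + k h l := by
    intro g h l
    have : ((k g h + k (g * h) l : ℤ) : ℝ) = ((k g (h * l) + k h l : ℤ) : ℝ) := by
      push_cast
      rw [← hk, ← hk, ← hk, ← hk, mul_assoc g]
      ring
    exact_mod_cast this
  have hk1 : ∀ g, k g 1 = 0 := by
    intro g
    have : ((k g 1 : ℤ) : ℝ) = 0 := by rw [← hk, mul_one, ht1]; ring
    exact_mod_cast this
  have h1k : ∀ g, k 1 g = 0 := by
    intro g
    have : ((k 1 g : ℤ) : ℝ) = 0 := by rw [← hk, one_mul, ht1]; ring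
    exact_mod_cast this
  -- `μ (ω g h) = exp (2π i k g h / p)` and `μ c₀ = exp (2π i / p)`, so dividing by `c₀ ^ k g h`
  -- moves the cocycle into `ker μ`.
  let ω₁ : Z2 G μ.ker := ⟨fun g h => ⟨ω.1 g h * c₀ ^ (-k g h), by
      rw [MonoidHom.mem_ker, map_mul, map_zpow, ← hτ, hc₀, ← Circle.exp_zsmul, ← Circle.exp_add]
      rw [zsmul_eq_mul]
      push_cast
      rw [← hk, ← Circle.exp_zero]
      congr 1
      field_simp
      ring⟩, by
    refine ⟨fun g h l => Subtype.ext ?_, fun g => Subtype.ext ?_, fun g => Subtype.ext ?_⟩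
    · change ω.1 g h * c₀ ^ (-k g h) * (ω.1 (g * h) l * c₀ ^ (-k (g * h) l)) =
        ω.1 g (h * l) * c₀ ^ (-k g (h * l)) * (ω.1 h l * c₀ ^ (-k h l))
      rw [mul_mul_mul_comm, ω.2.1, ← zpow_add, mul_mul_mul_comm, ← zpow_add, ← neg_add, hkcocycle,
        neg_add]
    · change ω.1 g 1 * c₀ ^ (-k g 1) = 1
      rw [ω.2.2.1, hk1, neg_zero, zpow_zero, one_mul]
    · change ω.1 1 g * c₀ ^ (-k 1 g) = 1
      rw [ω.2.2.2, h1k, neg_zero, zpow_zero, one_mul]⟩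
  have hinl : Function.Injective (MonoidHom.inl μ.ker (C ⧸ μ.ker)) :=
    fun a b hab => congrArg Prod.fst hab
  refine ⟨Z2.map (MonoidHom.id G) (MonoidHom.inl μ.ker (C ⧸ μ.ker)) ω₁, ?_,
    ⟨μ.ker, _, MonoidHom.ofInjective hinl, ?_, ?_⟩, (1, QuotientGroup.mk c₀), ?_, ?_⟩
  · obtain ⟨s, hs⟩ := MonoidHom.exists_extension_of_rootable CircleMaps.exists_pow_eq
      μ.ker.subtype μ.ker.subtype_injective (dualEval μ.ker)
    have hu := isFourierModel_productModel (s := s) (v := dualEval (C ⧸ μ.ker))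
      (q := QuotientGroup.mk' μ.ker)
      (μ := dualHaar μ.ker) μ.ker.subtype (QuotientGroup.mk'_surjective _)
      (fun m => (QuotientGroup.eq_one_iff _).2 m.2)
      (fun d hd => ⟨⟨d, (QuotientGroup.eq_one_iff _).1 hd⟩, rfl⟩) (isFourierModel_dualEval _)
      (by rw [hs]; exact isFourierModel_dualEval _)
    have hπ := isFourierModel_productModel
      (s := (dualEval μ.ker).comp (MonoidHom.fst μ.ker (C ⧸ μ.ker))) (v := dualEval (C ⧸ μ.ker))
      (q := MonoidHom.snd μ.ker (C ⧸ μ.ker))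
      (μ := dualHaar μ.ker) (MonoidHom.inl μ.ker (C ⧸ μ.ker)) Prod.snd_surjective
      (fun m => rfl) (fun d hd => ⟨d.1, Prod.ext rfl (Eq.symm hd)⟩) (isFourierModel_dualEval _)
      (by
        rw [MonoidHom.comp_assoc, MonoidHom.fst_comp_inl, MonoidHom.comp_id]
        exact isFourierModel_dualEval _)
    set u := productModel s (dualEval (C ⧸ μ.ker)) (QuotientGroup.mk' μ.ker) with hu_def
    -- With a logarithm `a` of `u c₀`, the cocycle `u c₀ ^ k` is a coboundary of real powers of `u
    -- c₀`, because `k` is the coboundary of `p t / (2π)`.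
    obtain ⟨a, ha, hca⟩ := CircleMaps.exists_ofAngle (u c₀)
    refine exists_intertwinesGroupVN_twistedProduct hu hπ hE hσ hσmul _
      (fun g => CircleMaps.ofAngle (fun x => -(p / (2 * Real.pi) * t g) * a x)
        (ha.const_mul _)) fun g h => ?_
    have h1 : productModel ((dualEval μ.ker).comp (MonoidHom.fst μ.ker (C ⧸ μ.ker)))
        (dualEval (C ⧸ μ.ker)) (MonoidHom.snd μ.ker (C ⧸ μ.ker)) (ω₁.1 g h, 1) =
        u (ω.1 g h) * u c₀ ^ (-k g h) := by
      rw [← map_zpow, ← map_mul]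
      change _ = u (ω₁.1 g h : C)
      have h2 : (QuotientGroup.mk' μ.ker) (ω₁.1 g h : C) = 1 :=
        (QuotientGroup.eq_one_iff _).2 (ω₁.1 g h).2
      have h3 : s (ω₁.1 g h : C) = dualEval μ.ker (ω₁.1 g h) := DFunLike.congr_fun hs (ω₁.1 g h)
      apply Subtype.ext
      funext z
      apply Circle.ext
      rw [hu_def, productModel_apply, productModel_apply, h2, h3]
      rfl
    have h4 : (Z2.map (MonoidHom.id G) (MonoidHom.inl μ.ker (C ⧸ μ.ker)) ω₁).1 g h =
        (ω₁.1 g h, 1) := rfl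
    rw [h4, h1, hca]
    apply Subtype.ext
    funext z
    change Circle.exp _ * Circle.exp _ * (u (ω.1 g h)).1 z = Circle.exp _ *
      ((u (ω.1 g h)).1 z * Circle.exp (a z) ^ (-k g h))
    rw [← Circle.exp_zsmul, mul_left_comm, ← Circle.exp_add, ← Circle.exp_add, mul_comm]
    congr 2
    rw [zsmul_eq_mul]
    push_cast
    rw [← hk]
    ring
  · rw [ENNReal.ofReal_one, mul_one, eIndex, eIndex]
    have hrange : (MonoidHom.inl μ.ker (C ⧸ μ.ker)).range =
        (MonoidHom.snd μ.ker (C ⧸ μ.ker)).ker := by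
      ext x
      constructor
      · rintro ⟨c, rfl⟩; rfl
      · intro hx; exact ⟨x.1, Prod.ext rfl (Eq.symm hx)⟩
    rw [hrange, ENat.card_congr (QuotientGroup.quotientKerEquivOfSurjective
      (MonoidHom.snd μ.ker (C ⧸ μ.ker)) Prod.snd_surjective).toEquiv]
  · intro μ' ν hν
    -- This is the same argument with the single number `μ' c₀` and its angle `b` in place of the
    -- function `u c₀`.
    have hb := Circle.exp_arg (μ' c₀)
    set b := Complex.arg (μ' c₀)
    refine QuotientGroup.eq.2 ⟨fun g => Circle.exp (-(b * (p / (2 * Real.pi)) * t g)), ?_,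
      fun g h => ?_⟩
    · simp [ht1]
    · have h1 : ν (ω₁.1 g h, 1) = μ' (ω.1 g h * c₀ ^ (-k g h)) := hν (ω₁.1 g h)
      change (μ' (ω.1 g h))⁻¹ * ν (ω₁.1 g h, 1) = _
      rw [h1, map_mul, inv_mul_cancel_left, map_zpow, ← hb, ← Circle.exp_zsmul, ← Circle.exp_add,
        ← div_eq_mul_inv, ← Circle.exp_sub]
      congr 1
      rw [zsmul_eq_mul]
      push_cast
      rw [← hk]
      ring
  · intro h1
    have h2 : c₀ ∈ μ.ker := (QuotientGroup.eq_one_iff _).1 (congrArg Prod.snd h1)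
    rw [MonoidHom.mem_ker, hc₀, ← Circle.exp_zero, Circle.exp_eq_exp] at h2
    obtain ⟨m, hm⟩ := h2
    rw [zero_add, div_eq_iff hp0] at hm
    have h3 : (1 : ℝ) = m * p := by
      apply mul_right_cancel₀ hpi
      rw [one_mul]; linear_combination hm
    have h4 : (1 : ℤ) = m * p := by exact_mod_cast h3
    have h5 : (p : ℤ) ∣ 1 := ⟨m, by rw [h4, mul_comm]⟩
    exact hp.one_lt.ne' (by exact_mod_cast Int.eq_one_of_dvd_one (by positivity) h5)
  · refine isOfFinOrder_iff_pow_eq_one.2 ⟨p, hp.pos, Prod.ext (one_pow p) ?_⟩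
    change (QuotientGroup.mk (c₀ ^ p) : C ⧸ μ.ker) = 1
    rw [QuotientGroup.eq_one_iff, MonoidHom.mem_ker, map_pow, hμpow]

end PrimeOrder

/-! ### Torsion of abelian groups -/

section TorsionFree

variable {C D : Type*} [CommGroup C] [CommGroup D]

theorem finite_isOfFinOrder_of_isMulTorsionFree (hC : IsMulTorsionFree C) :
    {c : C | IsOfFinOrder c}.Finite := by
  refine (Set.finite_singleton 1).subset fun c hc => ?_
  by_contra hne
  exact isMulTorsionFree_iff_not_isOfFinOrder.1 hC hne hc

/-- The torsion of an abelian group is finite if a finite index subgroup is torsion free. -/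
theorem finite_isOfFinOrder_of_finiteIndex (hC : IsMulTorsionFree C) {D₀ : Subgroup D}
    (hD₀ : D₀.FiniteIndex) (f : D₀ →* C) (hf : Function.Injective f) :
    {d : D | IsOfFinOrder d}.Finite := by
  refine Finite.of_injective
    (fun d : {d : D | IsOfFinOrder d} => (QuotientGroup.mk d.1 : D ⧸ D₀)) ?_
  -- Torsion elements in the same coset of `D₀` differ by torsion of `D₀`, which is trivial as `D₀`
  -- embeds in `C`.
  intro a b hab
  have h1 : a.1⁻¹ * b.1 ∈ D₀ := QuotientGroup.eq.1 hab
  have h2 : IsOfFinOrder (⟨_, h1⟩ : D₀) := by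
    rw [← D₀.subtype_injective.isOfFinOrder_iff (f := D₀.subtype)]
    exact a.2.inv.mul b.2
  have h3 : f ⟨_, h1⟩ = 1 := by
    by_contra hne
    exact isMulTorsionFree_iff_not_isOfFinOrder.1 hC hne (f.isOfFinOrder h2)
  have h4 : (⟨_, h1⟩ : D₀) = 1 := hf (by rw [h3, map_one])
  exact Subtype.ext (inv_mul_eq_one.1 (congrArg Subtype.val h4))

/-- In a commutative group, a nontrivial element of finite order has a power of prime order. -/
theorem exists_pow_orderOf_prime {x : D} (hx : x ≠ 1) (hfin : IsOfFinOrder x) :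
    ∃ n : ℕ, (orderOf (x ^ n)).Prime := by
  have h1 : orderOf x ≠ 1 := fun h => hx (orderOf_eq_one_iff.1 h)
  obtain ⟨p, hp, hpx⟩ := Nat.exists_prime_and_dvd h1
  refine ⟨orderOf x / p, ?_⟩
  rw [orderOf_pow_orderOf_div hfin.orderOf_pos.ne' hpx]
  exact hp

/-- A countable infinite abelian group of exponent two. -/
abbrev CountableBooleanGroup : Type u := ULift.{u} (Multiplicative (ℕ →₀ ZMod 2))

theorem isOfFinOrder_countableBooleanGroup (v : CountableBooleanGroup.{u}) : IsOfFinOrder v := by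
  refine isOfFinOrder_iff_pow_eq_one.2 ⟨2, two_pos, ?_⟩
  apply ULift.ext
  change Multiplicative.ofAdd (2 • v.down.toAdd) = Multiplicative.ofAdd 0
  congr 1
  ext i
  rw [Finsupp.smul_apply, two_nsmul, Finsupp.zero_apply]
  exact CharTwo.add_self_eq_zero _

instance : Countable CountableBooleanGroup.{u} :=
  have : Countable (ℕ →₀ ZMod 2) := inferInstance
  have : Countable (Multiplicative (ℕ →₀ ZMod 2)) := this
  inferInstance

instance : Infinite CountableBooleanGroup.{u} :=
  Infinite.of_injective (fun n : ℕ => ULift.up (Multiplicative.ofAdd (Finsupp.single n (1 : ZMod 2))))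
    fun _ _ h => Finsupp.single_left_injective one_ne_zero
      (congrArg (fun x : CountableBooleanGroup.{u} => x.down.toAdd) h)

end TorsionFree

/-! ### Assembling the two constructions -/

/-- A nontrivial kernel element of finite order has a power of prime order, and one of infinite
order makes the kernel infinite. In the second case both indices are infinite, so the relation holds
with `t = 1`. -/
theorem GroupExtension.exists_cocycle_of_not_injective_theta {G C Γ : Type u} [Group G]
    [CommGroup C] [Group Γ] [Countable C] {E : GroupExtension C Γ G} (hE : E.IsCentral)
    {Ω : H2 G C} (hΩ : E.HasClass Ω) (h : ¬ Function.Injective (Theta Ω)) :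
    ∃ (D : Type u) (_ : CommGroup D) (_ : Countable D) (ω' : Z2 G D),
      (∃ W : Ell2 (TwistedProduct ω') ≃ₗᵢ[ℂ] Ell2 Γ, IntertwinesGroupVN W) ∧
      CocycleSimT 1 Ω (QuotientGroup.mk ω' : H2 G D) ∧ ∃ d : D, d ≠ 1 ∧ IsOfFinOrder d := by
  rw [injective_iff_map_eq_one] at h
  push Not at h
  obtain ⟨μ, hμ, hμ1⟩ := h
  by_cases hfin : IsOfFinOrder μ
  · obtain ⟨n, hn⟩ := exists_pow_orderOf_prime hμ1 hfin
    obtain ⟨ω', h1, h2, h3⟩ := GroupExtension.exists_cocycle_of_orderOf_prime hE hΩ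
      (μ := μ ^ n) (by rw [map_pow, hμ, one_pow]) hn rfl
    exact ⟨_, _, inferInstance, ω', h1, h2, h3⟩
  · have hinf : Infinite (Theta Ω).ker :=
      Infinite.of_injective (fun n : ℕ => (⟨μ, hμ⟩ : (Theta Ω).ker) ^ n)
        fun a b hab => injective_pow_iff_not_isOfFinOrder.2 hfin (congrArg Subtype.val hab)
    obtain ⟨ω', h1, C₀, D₀, ζ, hC₀, hD₀, hζ⟩ :=
      GroupExtension.exists_cocycle_prod CountableBooleanGroup.{u} hE hΩ hinf
    obtain ⟨v, hv⟩ := exists_ne (1 : CountableBooleanGroup.{u})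
    refine ⟨_, _, inferInstance, ω', h1, ⟨C₀, D₀, ζ, by simp [hC₀, hD₀], hζ⟩, (1, v),
      fun h => hv (congrArg Prod.snd h), ?_⟩
    exact (MonoidHom.inr C CountableBooleanGroup.{u}).isOfFinOrder
      (isOfFinOrder_countableBooleanGroup v)

theorem mainTheorem9 {G C Gt : Type u} [Group G] [CommGroup C] [Group Gt]
    [Countable G] [Countable C] (hG : IsICC G) (hC : IsMulTorsionFree C)
    (E : GroupExtension C Gt G) (hE : E.IsCentral) (Ω : H2 G C) (hΩ : E.HasClass Ω) :
    (¬ Function.Injective (Theta Ω) →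
      ∃ (Λt : Type u) (_ : Group Λt) (_ : Countable Λt),
        ClassHSim 1 Ω Λt ∧ ¬ ClassHApprox Ω Λt ∧
        Nonempty (LvN Λt ≃⋆ₐ[ℂ] LvN Gt) ∧ ¬ Nonempty (Λt ≃* Gt)) ∧
    (∀ G₀ : Subgroup G, G₀.FiniteIndex → Infinite (Theta (Ω.restrict G₀)).ker →
      ∃ (Λt : Type u) (_ : Group Λt) (_ : Countable Λt),
        ClassFSim Ω Λt ∧ ExistsFaithfulBifiniteBimodule Λt Gt ∧
        ¬ VirtuallyIsomorphic Λt Gt ∧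
        ∀ (Γ : Type u) [Group Γ], ClassFApproxVirtual Ω Γ → ¬ VirtuallyIsomorphic Λt Γ) := by
  constructor
  · intro hinj
    obtain ⟨D, _, _, ω', ⟨W, hW⟩, hsim, d, hd, hdfin⟩ :=
      GroupExtension.exists_cocycle_of_not_injective_theta hE hΩ hinj
    -- This nontrivial central torsion element rules out both an isomorphism with `Gt` and any
    -- description as an extension of `G` by `C`.
    have hx : (TwistedProduct.extension ω').inl d ≠ 1 := fun h =>
      hd ((TwistedProduct.extension ω').inl_injective (by rw [h, map_one]))
    have hxfin := (TwistedProduct.extension ω').inl.isOfFinOrder hdfin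
    refine ⟨TwistedProduct ω', inferInstance, inferInstance,
      ⟨inferInstance, D, _, inferInstance, TwistedProduct.extension ω', _,
        TwistedProduct.isCentral_extension ω', TwistedProduct.hasClass_extension ω', hsim⟩,
      ?_, ⟨hW.equiv⟩, ?_⟩
    · rintro ⟨-, S, -, -, -, -⟩
      exact hx (eq_one_of_central_of_isOfFinOrder hG hC S (TwistedProduct.inl_comm ω' d) hxfin)
    · rintro ⟨e⟩
      refine hx (e.injective (Eq.trans (eq_one_of_central_of_isOfFinOrder hG hC E (fun y => ?_)
        (e.toMonoidHom.isOfFinOrder hxfin)) (map_one e).symm))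
      obtain ⟨y, rfl⟩ := e.surjective y
      rw [← map_mul, TwistedProduct.inl_comm, map_mul]
  · intro G₀ hG₀ hinf
    obtain ⟨ω', ⟨W, hW⟩, C₀, D₀, ζ, hC₀, hD₀, hζ⟩ :=
      GroupExtension.exists_cocycle_prod CountableBooleanGroup.{u} (hE.restrict G₀)
        (hΩ.restrict G₀) hinf
    -- The factor `V` is an infinite central torsion subgroup of the new group, so a virtually
    -- isomorphic group has infinite `fcTorsion`.
    have hnot : ∀ (Γ : Type u) [Group Γ], (fcTorsion Γ).Finite →
        ¬ VirtuallyIsomorphic (TwistedProduct ω') Γ := fun Γ _ hΓ hiso =>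
      infinite_fcTorsion_of_virtuallyIsomorphic isOfFinOrder_countableBooleanGroup
        ((TwistedProduct.extension ω').inl.comp (MonoidHom.inr C CountableBooleanGroup.{u}))
        ((TwistedProduct.extension ω').inl_injective.comp fun a b h => congrArg Prod.snd h)
        (fun v x => TwistedProduct.inl_comm ω' _ x) hiso hΓ
    refine ⟨TwistedProduct ω', inferInstance, inferInstance,
      ⟨inferInstance, G₀, _, _, inferInstance, TwistedProduct.extension ω', _, hG₀,
        TwistedProduct.isCentral_extension ω', TwistedProduct.hasClass_extension ω',
        1, one_pos, D₀, C₀, ζ.symm, by simp [hC₀, hD₀], hζ.symm⟩,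
      existsFaithfulBifiniteBimodule_of_intertwines _ ?_ hW,
      hnot Gt (finite_fcTorsion hG E (finite_isOfFinOrder_of_isMulTorsionFree hC)), ?_⟩
    · exact ⟨by rw [Subgroup.index_comap_of_surjective G₀ E.rightHom_surjective]; exact hG₀.1⟩
    -- Here the kernel `D'` has a finite index subgroup isomorphic to a subgroup of `C`, so its
    -- torsion is finite, and `G₁` is again icc.
    · rintro Γ _ ⟨-, G₁, D', _, -, S, Ω', hG₁, -, -, C₁, D₁, ζ', hC₁, -, -⟩
      exact hnot Γ (finite_fcTorsion (hG.of_finiteIndex G₁) S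
        (finite_isOfFinOrder_of_finiteIndex hC hC₁ (D₁.subtype.comp ζ'.toMonoidHom)
          (D₁.subtype_injective.comp ζ'.injective)))
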